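/- Let $d,d',d_0\ge 0$ be integers, $\bar d=(d,d',d_0)$, and let $\mathbb R^{\bar d}=\mathbb R^{d}\times\mathbb R^{d'}\times\mathbb R^{d_0}$, with points $(y,y',z)$, be the double vector space of dimension $\bar d$, with its two commuting families of homotheties $h^1_t(y,y',z)=(ty,y',tz)$ and $h^2_t(y,y',z)=(y,ty',tz)$, $t\in\mathbb R$. Let $\mathbb G=\mathrm{Aut}(\mathbb R^{\bar d})$ be the group of maps $$(y,y',z)\mapsto(\alpha y,\ \alpha' y',\ \beta(y,y')+\sigma z),\qquad \alpha\in GL(d),\ \alpha'\in GL(d'),\ \sigma\in GL(d_0),\ \beta:\mathbb R^{d}\times\mathbb R^{d'}\to\mathbb R^{d_0}\ \text{bilinear}$$ (with the manifold structure given by the coordinates $\alpha,\alpha',\sigma,\beta$), and let $G,G'\subset\mathbb G$ be the subgroups defined by $\alpha=\mathrm{id}$ and by $\alpha'=\mathrm{id}$, respectively. A double vector bundle of dimension $\bar d$ over a smooth manifold $M$ is a smooth manifold $E$ with a smooth map $E\to M$ and two commuting smooth actions $h^1,h^2$ of the multiplicative monoid $\mathbb R$ preserving the fibres, which locally over $M$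 is isomorphic to $U\times\mathbb R^{\bar d}$ with the homotheties above; its morphisms over $M$ are the smooth maps covering $\mathrm{id}_M$ that commute with $h^1$ and $h^2$. Morphisms of principal $\mathbb G$-bundles over $M$ are the smooth $\mathbb G$-equivariant maps covering $\mathrm{id}_M$. Theorem. (a) $\mathbb G$ is exactly the group of all diffeomorphisms of $\mathbb R^{\bar d}$ that commute with $h^1$ and $h^2$ (each of them being given by a unique $(\alpha,\alpha',\sigma,\beta)$), and $(\mathbb G;G,G')$ is a double principal group: $\mathbb G$ is a Lie group, and $G,G'$ are closed normal subgroups whose union generates $\mathbb G$. (b) For every smooth (Hausdorff, second countable, finite-dimensional) manifold $M$, the associated bundle construction $P\mapsto P\times_{\mathbb G}\mathbb R^{\bar d}=(P\times\mathbb R^{\bar d})/\mathbb G$, where $(p,v)g=(pg,g^{-1}v)$, acting on morphisms by $[p,v]\mapsto[f(p),v]$, is an equivalence from the category of principal $\mathbb G$-bundles over $M$ to the category whose objects are the double vector bundles of dimension $\bar d$ over $M$ and whose morphisms are the isomorphisms of double vector bundles over $M$. Its inverse is the frame bundle construction, which assigns to $E$ the principal $\mathbb G$-bundle whose fibre over $x\in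 M$ is the set of isomorphisms of double vector spaces $\psi:\mathbb R^{\bar d}\to E_x$, with $\mathbb G$ acting by $\psi g=\psi\circ g$, and to an isomorphism $f:E\to F$ the map $\psi\mapsto f\circ\psi$. The natural isomorphisms of the equivalence are $p\mapsto(v\mapsto[p,v])$ and $[\psi,v]\mapsto\psi(v)$. -/

import Mathlib

open CategoryTheory
open scoped Manifold ContDiff

universe u

noncomputable section

/-! ### Double vector spaces and their automorphisms -/

/-- The double vector space `ℝ^d × ℝ^{d'} × ℝ^{d₀}` of dimension `(d, d', d₀)`, with points
`(y, y', z)`. -/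
abbrev DVS (d d' d₀ : ℕ) : Type := (Fin d → ℝ) × (Fin d' → ℝ) × (Fin d₀ → ℝ)

namespace DVS

variable {d d' d₀ : ℕ}

/-- Multiplication by `t` in the first vector bundle structure `(y, y', z) ↦ y'`. -/
def h₁ (t : ℝ) (v : DVS d d' d₀) : DVS d d' d₀ := (t • v.1, v.2.1, t • v.2.2)

/-- Multiplication by `t` in the second vector bundle structure `(y, y', z) ↦ y`. -/
def h₂ (t : ℝ) (v : DVS d d' d₀) : DVS d d' d₀ := (v.1, t • v.2.1, t • v.2.2)

end DVS

/-- The vector space of bilinear maps `ℝ^d × ℝ^{d'} → ℝ^{d₀}`. -/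
abbrev DVBil (d d' d₀ : ℕ) : Type :=
  (Fin d → ℝ) →L[ℝ] (Fin d' → ℝ) →L[ℝ] (Fin d₀ → ℝ)

/-- The linear endomorphisms of `ℝ^k`. -/
abbrev DVEnd (k : ℕ) : Type := (Fin k → ℝ) →L[ℝ] (Fin k → ℝ)

/-- The automorphism group of the double vector space `ℝ^d × ℝ^{d'} × ℝ^{d₀}`: an element is a
quadruple `(α, α', σ, β)` with `α`, `α'`, `σ` linear automorphisms and `β` bilinear; it stands for
`(y, y', z) ↦ (α y, α' y', β (y, y') + σ z)`. -/
def DVAut (d d' d₀ : ℕ) : Type :=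
  (DVEnd d)ˣ × (DVEnd d')ˣ × (DVEnd d₀)ˣ × DVBil d d' d₀

/-- The vector space on which the group `DVAut d d' d₀` is modelled as a manifold. -/
abbrev DVAutE (d d' d₀ : ℕ) : Type := DVEnd d × DVEnd d' × DVEnd d₀ × DVBil d d' d₀

/-- The model space of the manifold `DVAut d d' d₀` (the vector space `DVAutE d d' d₀`, written as
a product of model spaces). -/
abbrev DVAutH (d d' d₀ : ℕ) : Type :=
  ModelProd (DVEnd d) (ModelProd (DVEnd d') (ModelProd (DVEnd d₀) (DVBil d d' d₀)))

/-- The model with corners (without boundary) of the manifold `DVAut d d' d₀`. -/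
abbrev DVAutI (d d' d₀ : ℕ) : ModelWithCorners ℝ (DVAutE d d' d₀) (DVAutH d d' d₀) :=
  𝓘(ℝ, DVEnd d).prod (𝓘(ℝ, DVEnd d').prod (𝓘(ℝ, DVEnd d₀).prod 𝓘(ℝ, DVBil d d' d₀)))

namespace DVAut

variable {d d' d₀ : ℕ}

instance : TopologicalSpace (DVAut d d' d₀) :=
  inferInstanceAs (TopologicalSpace ((DVEnd d)ˣ × (DVEnd d')ˣ × (DVEnd d₀)ˣ × DVBil d d' d₀))

/-- The manifold structure of an open subset of a finite-dimensional vector space. -/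
instance : ChartedSpace (DVAutH d d' d₀) (DVAut d d' d₀) :=
  inferInstanceAs (ChartedSpace
    (ModelProd (DVEnd d) (ModelProd (DVEnd d') (ModelProd (DVEnd d₀) (DVBil d d' d₀))))
    ((DVEnd d)ˣ × (DVEnd d')ˣ × (DVEnd d₀)ˣ × DVBil d d' d₀))

/-- The linear part in the variable `y`. -/
def α (g : DVAut d d' d₀) : (DVEnd d)ˣ := g.1

/-- The linear part in the variable `y'`. -/
def α' (g : DVAut d d' d₀) : (DVEnd d')ˣ := g.2.1

/-- The linear part in the variable `z`. -/
def σ (g : DVAut d d' d₀) : (DVEnd d₀)ˣ := g.2.2.1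

/-- The bilinear part. -/
def β (g : DVAut d d' d₀) : DVBil d d' d₀ := g.2.2.2

@[ext] theorem ext {g h : DVAut d d' d₀} (h1 : g.α = h.α) (h2 : g.α' = h.α') (h3 : g.σ = h.σ)
    (h4 : g.β = h.β) : g = h :=
  Prod.ext h1 (Prod.ext h2 (Prod.ext h3 h4))

/-- The bilinear map `(y, y') ↦ s (b (a y, a' y'))`. -/
def conj (s : DVEnd d₀) (b : DVBil d d' d₀) (a : DVEnd d) (a' : DVEnd d') : DVBil d d' d₀ :=
  (ContinuousLinearMap.compL ℝ (Fin d' → ℝ) (Fin d₀ → ℝ) (Fin d₀ → ℝ) s).comp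
    (b.bilinearComp a a')

@[simp] theorem conj_apply (s : DVEnd d₀) (b : DVBil d d' d₀) (a : DVEnd d) (a' : DVEnd d')
    (y : Fin d → ℝ) (y' : Fin d' → ℝ) : conj s b a a' y y' = s (b (a y) (a' y')) := rfl

instance : One (DVAut d d' d₀) := ⟨(1, 1, 1, 0)⟩

instance : Mul (DVAut d d' d₀) :=
  ⟨fun g h => (g.α * h.α, g.α' * h.α', g.σ * h.σ,
    conj 1 g.β (h.α : DVEnd d) (h.α' : DVEnd d') + conj (g.σ : DVEnd d₀) h.β 1 1)⟩

instance : Inv (DVAut d d' d₀) :=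
  ⟨fun g => (g.α⁻¹, g.α'⁻¹, g.σ⁻¹,
    - conj ((g.σ⁻¹ : (DVEnd d₀)ˣ) : DVEnd d₀) g.β
      ((g.α⁻¹ : (DVEnd d)ˣ) : DVEnd d) ((g.α'⁻¹ : (DVEnd d')ˣ) : DVEnd d'))⟩

@[simp] theorem one_α : (1 : DVAut d d' d₀).α = 1 := rfl
@[simp] theorem one_α' : (1 : DVAut d d' d₀).α' = 1 := rfl
@[simp] theorem one_σ : (1 : DVAut d d' d₀).σ = 1 := rfl
@[simp] theorem one_β : (1 : DVAut d d' d₀).β = 0 := rfl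
@[simp] theorem mul_α (g h : DVAut d d' d₀) : (g * h).α = g.α * h.α := rfl
@[simp] theorem mul_α' (g h : DVAut d d' d₀) : (g * h).α' = g.α' * h.α' := rfl
@[simp] theorem mul_σ (g h : DVAut d d' d₀) : (g * h).σ = g.σ * h.σ := rfl
@[simp] theorem mul_β (g h : DVAut d d' d₀) : (g * h).β =
    conj 1 g.β (h.α : DVEnd d) (h.α' : DVEnd d') + conj (g.σ : DVEnd d₀) h.β 1 1 := rfl
@[simp] theorem inv_α (g : DVAut d d' d₀) : (g⁻¹).α = g.α⁻¹ := rfl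
@[simp] theorem inv_α' (g : DVAut d d' d₀) : (g⁻¹).α' = g.α'⁻¹ := rfl
@[simp] theorem inv_σ (g : DVAut d d' d₀) : (g⁻¹).σ = g.σ⁻¹ := rfl
@[simp] theorem inv_β (g : DVAut d d' d₀) : (g⁻¹).β =
    - conj ((g.σ⁻¹ : (DVEnd d₀)ˣ) : DVEnd d₀) g.β
      ((g.α⁻¹ : (DVEnd d)ˣ) : DVEnd d) ((g.α'⁻¹ : (DVEnd d')ˣ) : DVEnd d') := rfl

theorem unit_inv_apply {k : ℕ} (a : (DVEnd k)ˣ) (y : Fin k → ℝ) :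
    ((a⁻¹ : (DVEnd k)ˣ) : DVEnd k) ((a : DVEnd k) y) = y := by
  rw [← mul_apply_eq_comp, Units.inv_mul, one_apply_eq_self]

instance : Group (DVAut d d' d₀) :=
  Group.ofLeftAxioms
    (by
      intro a b c
      ext1
      · simp [mul_assoc]
      · simp [mul_assoc]
      · simp [mul_assoc]
      · refine ContinuousLinearMap.ext fun y => ContinuousLinearMap.ext fun y' => ?_
        simp [add_assoc])
    (by
      intro a
      ext1
      · simp
      · simp
      · simp
      · refine ContinuousLinearMap.ext fun y => ContinuousLinearMap.ext fun y' => ?_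
        simp)
    (by
      intro a
      ext1
      · simp
      · simp
      · simp
      · refine ContinuousLinearMap.ext fun y => ContinuousLinearMap.ext fun y' => ?_
        simp only [mul_β, inv_β, inv_σ, one_β, add_apply,
          neg_apply, zero_apply, conj_apply,
          one_apply_eq_self, unit_inv_apply]
        exact neg_add_cancel _)

/-- The action `(y, y', z) ↦ (α y, α' y', β (y, y') + σ z)` of the automorphism group. -/
instance : MulAction (DVAut d d' d₀) (DVS d d' d₀) where
  smul g v := ((g.α : DVEnd d) v.1, (g.α' : DVEnd d') v.2.1,
    g.β v.1 v.2.1 + (g.σ : DVEnd d₀) v.2.2)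
  one_smul v := by
    change ((((1 : DVAut d d' d₀).α : DVEnd d)) v.1, _, _) = v
    ext <;> simp
  mul_smul g h v := by
    change ((((g * h).α : DVEnd d)) v.1, (((g * h).α' : DVEnd d')) v.2.1,
      (g * h).β v.1 v.2.1 + ((g * h).σ : DVEnd d₀) v.2.2) =
      ((g.α : DVEnd d) ((h.α : DVEnd d) v.1), (g.α' : DVEnd d') ((h.α' : DVEnd d') v.2.1),
        g.β ((h.α : DVEnd d) v.1) ((h.α' : DVEnd d') v.2.1) +
          (g.σ : DVEnd d₀) (h.β v.1 v.2.1 + (h.σ : DVEnd d₀) v.2.2))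
    simp [add_assoc]

theorem smul_def (g : DVAut d d' d₀) (v : DVS d d' d₀) :
    g • v = ((g.α : DVEnd d) v.1, (g.α' : DVEnd d') v.2.1,
      g.β v.1 v.2.1 + (g.σ : DVEnd d₀) v.2.2) := rfl

variable (d d' d₀)

/-- The subgroup of automorphisms acting trivially on `y`. -/
def fixFst : Subgroup (DVAut d d' d₀) where
  carrier := {g | g.α = 1}
  mul_mem' := by
    intro a b ha hb
    simp only [Set.mem_ofPred_eq] at *
    simp [ha, hb]
  one_mem' := rfl
  inv_mem' := by
    intro a ha
    simp only [Set.mem_ofPred_eq] at *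
    simp [ha]

/-- The subgroup of automorphisms acting trivially on `y'`. -/
def fixSnd : Subgroup (DVAut d d' d₀) where
  carrier := {g | g.α' = 1}
  mul_mem' := by
    intro a b ha hb
    simp only [Set.mem_ofPred_eq] at *
    simp [ha, hb]
  one_mem' := rfl
  inv_mem' := by
    intro a ha
    simp only [Set.mem_ofPred_eq] at *
    simp [ha]

end DVAut

/-- A double principal group: a (Hausdorff, second countable) Lie group `𝔾` with two closed normal
subgroups `G`, `G'` whose union generates `𝔾`. -/
structure IsDoublePrincipalGroup {EG : Type*} [NormedAddCommGroup EG] [NormedSpace ℝ EG]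
    {HG : Type*} [TopologicalSpace HG] (IG : ModelWithCorners ℝ EG HG)
    (𝔾 : Type*) [TopologicalSpace 𝔾] [ChartedSpace HG 𝔾] [Group 𝔾] (G G' : Subgroup 𝔾) :
    Prop where
  lieGroup : LieGroup IG ∞ 𝔾
  t2 : T2Space 𝔾
  secondCountable : SecondCountableTopology 𝔾
  normal_left : G.Normal
  normal_right : G'.Normal
  closed_left : IsClosed (G : Set 𝔾)
  closed_right : IsClosed (G' : Set 𝔾)
  generates : Subgroup.closure ((G : Set 𝔾) ∪ (G' : Set 𝔾)) = ⊤

/-! ### Principal bundles -/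

section Principal

variable (n : ℕ) (M : Type u) [TopologicalSpace M] [ChartedSpace (EuclideanSpace ℝ (Fin n)) M]
  {EG : Type} [NormedAddCommGroup EG] [NormedSpace ℝ EG]
  {HG : Type} [TopologicalSpace HG] (IG : ModelWithCorners ℝ EG HG)
  (G : Type) [TopologicalSpace G] [ChartedSpace HG G] [Group G]

/-- A smooth principal `G`-bundle over the manifold `M`: a manifold `Total` with a free smooth right
action of `G`, and a smooth surjection `proj` onto `M` whose fibres are the orbits, which locally
over `M` is equivariantly diffeomorphic to `U × G`. -/
structure PrincipalBundle where
  Total : Type u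
  [topology : TopologicalSpace Total]
  [charted : ChartedSpace (ModelProd (EuclideanSpace ℝ (Fin n)) HG) Total]
  [isManifold : IsManifold ((𝓡 n).prod IG) ∞ Total]
  [t2 : T2Space Total]
  [secondCountable : SecondCountableTopology Total]
  proj : Total → M
  act : Total → G → Total
  act_one : ∀ p, act p 1 = p
  act_mul : ∀ p g h, act p (g * h) = act (act p g) h
  contMDiff_act : ContMDiff (((𝓡 n).prod IG).prod IG) ((𝓡 n).prod IG) ∞
    (fun z : Total × G => act z.1 z.2)
  contMDiff_proj : ContMDiff ((𝓡 n).prod IG) (𝓡 n) ∞ proj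
  free : ∀ p g, act p g = p → g = 1
  proj_eq_iff : ∀ p q, proj p = proj q ↔ ∃ g, q = act p g
  surjective_proj : Function.Surjective proj
  locallyTrivial : ∀ x : M, ∃ U : Set M, IsOpen U ∧ x ∈ U ∧
    ∃ φ : OpenPartialHomeomorph Total (M × G),
      φ.source = proj ⁻¹' U ∧ φ.target = U ×ˢ Set.univ ∧
      ContMDiffOn ((𝓡 n).prod IG) ((𝓡 n).prod IG) ∞ φ φ.source ∧
      ContMDiffOn ((𝓡 n).prod IG) ((𝓡 n).prod IG) ∞ φ.symm φ.target ∧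
      ∀ p ∈ φ.source, (φ p).1 = proj p ∧
        ∀ g, φ (act p g) = ((φ p).1, (φ p).2 * g)

attribute [instance] PrincipalBundle.topology PrincipalBundle.charted PrincipalBundle.isManifold
  PrincipalBundle.t2 PrincipalBundle.secondCountable

variable {n M IG G}

/-- Morphisms of principal `G`-bundles over `M`: smooth `G`-equivariant maps covering the identity
of `M`. -/
@[ext]
structure PrincipalBundle.Hom (P Q : PrincipalBundle n M IG G) where
  toFun : P.Total → Q.Total
  contMDiff : ContMDiff ((𝓡 n).prod IG) ((𝓡 n).prod IG) ∞ toFun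
  proj_comp : ∀ p, Q.proj (toFun p) = P.proj p
  equivariant : ∀ p g, toFun (P.act p g) = Q.act (toFun p) g

/-- The category of principal `G`-bundles over `M`. -/
instance PrincipalBundle.category : Category (PrincipalBundle n M IG G) where
  Hom P Q := PrincipalBundle.Hom P Q
  id P := ⟨id, contMDiff_id, fun _ => rfl, fun _ _ => rfl⟩
  comp f g := ⟨g.toFun ∘ f.toFun, g.contMDiff.comp f.contMDiff,
    fun p => (g.proj_comp _).trans (f.proj_comp p),
    fun p a => (congrArg g.toFun (f.equivariant p a)).trans (g.equivariant _ a)⟩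

end Principal

/-! ### Double vector bundles -/

section DVB

variable (n : ℕ) (M : Type u) [TopologicalSpace M] [ChartedSpace (EuclideanSpace ℝ (Fin n)) M]
  (d d' d₀ : ℕ)

/-- A double vector bundle of dimension `(d, d', d₀)` over `M`: a manifold `Total` fibred over `M`,
with two commuting smooth fibrewise actions `h₁`, `h₂` of the multiplicative monoid `ℝ` (the
homotheties of the two vector bundle structures), which locally over `M` is isomorphic to
`U × ℝ^d × ℝ^{d'} × ℝ^{d₀}` with its standard homotheties. -/
structure DoubleVectorBundle where
  Total : Type u
  [topology : TopologicalSpace Total]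
  [charted : ChartedSpace (ModelProd (EuclideanSpace ℝ (Fin n)) (DVS d d' d₀)) Total]
  [isManifold : IsManifold ((𝓡 n).prod 𝓘(ℝ, DVS d d' d₀)) ∞ Total]
  [t2 : T2Space Total]
  [secondCountable : SecondCountableTopology Total]
  proj : Total → M
  contMDiff_proj : ContMDiff ((𝓡 n).prod 𝓘(ℝ, DVS d d' d₀)) (𝓡 n) ∞ proj
  h₁ : ℝ → Total → Total
  h₂ : ℝ → Total → Total
  h₁_one : ∀ e, h₁ 1 e = e
  h₂_one : ∀ e, h₂ 1 e = e
  h₁_mul : ∀ s t e, h₁ (s * t) e = h₁ s (h₁ t e)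
  h₂_mul : ∀ s t e, h₂ (s * t) e = h₂ s (h₂ t e)
  h_comm : ∀ s t e, h₁ s (h₂ t e) = h₂ t (h₁ s e)
  contMDiff_h₁ : ContMDiff (𝓘(ℝ, ℝ).prod ((𝓡 n).prod 𝓘(ℝ, DVS d d' d₀)))
    ((𝓡 n).prod 𝓘(ℝ, DVS d d' d₀)) ∞ (fun z : ℝ × Total => h₁ z.1 z.2)
  contMDiff_h₂ : ContMDiff (𝓘(ℝ, ℝ).prod ((𝓡 n).prod 𝓘(ℝ, DVS d d' d₀)))
    ((𝓡 n).prod 𝓘(ℝ, DVS d d' d₀)) ∞ (fun z : ℝ × Total => h₂ z.1 z.2)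
  proj_h₁ : ∀ t e, proj (h₁ t e) = proj e
  proj_h₂ : ∀ t e, proj (h₂ t e) = proj e
  locallyTrivial : ∀ x : M, ∃ U : Set M, IsOpen U ∧ x ∈ U ∧
    ∃ φ : OpenPartialHomeomorph Total (M × DVS d d' d₀),
      φ.source = proj ⁻¹' U ∧ φ.target = U ×ˢ Set.univ ∧
      ContMDiffOn ((𝓡 n).prod 𝓘(ℝ, DVS d d' d₀)) ((𝓡 n).prod 𝓘(ℝ, DVS d d' d₀)) ∞
        φ φ.source ∧
      ContMDiffOn ((𝓡 n).prod 𝓘(ℝ, DVS d d' d₀)) ((𝓡 n).prod 𝓘(ℝ, DVS d d' d₀)) ∞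
        φ.symm φ.target ∧
      ∀ e ∈ φ.source, (φ e).1 = proj e ∧
        ∀ t, φ (h₁ t e) = ((φ e).1, DVS.h₁ t (φ e).2) ∧
          φ (h₂ t e) = ((φ e).1, DVS.h₂ t (φ e).2)

attribute [instance] DoubleVectorBundle.topology DoubleVectorBundle.charted
  DoubleVectorBundle.isManifold DoubleVectorBundle.t2 DoubleVectorBundle.secondCountable

variable {n M d d' d₀}

/-- Morphisms of double vector bundles over `M`: smooth maps covering the identity of `M` and
commuting with both families of homotheties. -/
@[ext]
structure DoubleVectorBundle.Hom (E F : DoubleVectorBundle n M d d' d₀) where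
  toFun : E.Total → F.Total
  contMDiff : ContMDiff ((𝓡 n).prod 𝓘(ℝ, DVS d d' d₀)) ((𝓡 n).prod 𝓘(ℝ, DVS d d' d₀)) ∞ toFun
  proj_comp : ∀ e, F.proj (toFun e) = E.proj e
  map_h₁ : ∀ t e, toFun (E.h₁ t e) = F.h₁ t (toFun e)
  map_h₂ : ∀ t e, toFun (E.h₂ t e) = F.h₂ t (toFun e)

/-- The category of double vector bundles of dimension `(d, d', d₀)` over `M`, with all morphisms;
its groupoid of isomorphisms is `Core (DoubleVectorBundle n M d d' d₀)`. -/
instance DoubleVectorBundle.category : Category (DoubleVectorBundle n M d d' d₀) where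
  Hom E F := DoubleVectorBundle.Hom E F
  id E := ⟨id, contMDiff_id, fun _ => rfl, fun _ _ => rfl, fun _ _ => rfl⟩
  comp f g := ⟨g.toFun ∘ f.toFun, g.contMDiff.comp f.contMDiff,
    fun e => (g.proj_comp _).trans (f.proj_comp e),
    fun t e => (congrArg g.toFun (f.map_h₁ t e)).trans (g.map_h₁ t _),
    fun t e => (congrArg g.toFun (f.map_h₂ t e)).trans (g.map_h₂ t _)⟩

/-! ### Associated bundle and frame bundle -/

/-- The principal bundles over `M` with structure group the automorphism group of the double vector
space `ℝ^d × ℝ^{d'} × ℝ^{d₀}`. -/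
abbrev DVPrincipal (n : ℕ) (M : Type u) [TopologicalSpace M]
    [ChartedSpace (EuclideanSpace ℝ (Fin n)) M] (d d' d₀ : ℕ) : Type (u + 1) :=
  PrincipalBundle n M (DVAutI d d' d₀) (DVAut d d' d₀)

/-- `q : P × ℝ^{(d,d',d₀)} → E`, written `q (p, v) = [p, v]`, exhibits the double vector bundle `E`
as the associated bundle `P ×_𝔾 ℝ^{(d,d',d₀)}`: it is the quotient map (a smooth surjective
submersion) for the right action `(p, v) g = (p g, g⁻¹ v)` of `𝔾`, and the projection and homotheties
of `E` are the ones induced on the quotient. -/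
structure IsAssociatedBundle (P : DVPrincipal n M d d' d₀) (E : DoubleVectorBundle n M d d' d₀)
    (q : P.Total × DVS d d' d₀ → E.Total) : Prop where
  contMDiff : ContMDiff (((𝓡 n).prod (DVAutI d d' d₀)).prod 𝓘(ℝ, DVS d d' d₀))
    ((𝓡 n).prod 𝓘(ℝ, DVS d d' d₀)) ∞ q
  surjective : Function.Surjective q
  submersion : ∀ z, Function.Surjective
    (mfderiv (((𝓡 n).prod (DVAutI d d' d₀)).prod 𝓘(ℝ, DVS d d' d₀))
      ((𝓡 n).prod 𝓘(ℝ, DVS d d' d₀)) q z)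
  eq_iff : ∀ p v p' v', q (p, v) = q (p', v') ↔
    ∃ g : DVAut d d' d₀, p' = P.act p g ∧ v' = g⁻¹ • v
  proj_mk : ∀ p v, E.proj (q (p, v)) = P.proj p
  h₁_mk : ∀ t p v, E.h₁ t (q (p, v)) = q (p, DVS.h₁ t v)
  h₂_mk : ∀ t p v, E.h₂ t (q (p, v)) = q (p, DVS.h₂ t v)

/-- A frame of `E` at `x`: an isomorphism of double vector spaces from `ℝ^d × ℝ^{d'} × ℝ^{d₀}` to the
fibre of `E` over `x`, i.e. a smooth bijection onto the fibre commuting with both families of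
homotheties (smoothness of the inverse is then automatic). -/
structure IsFrame (E : DoubleVectorBundle n M d d' d₀) (x : M) (ψ : DVS d d' d₀ → E.Total) :
    Prop where
  contMDiff : ContMDiff 𝓘(ℝ, DVS d d' d₀) ((𝓡 n).prod 𝓘(ℝ, DVS d d' d₀)) ∞ ψ
  bijOn : Set.BijOn ψ Set.univ (E.proj ⁻¹' {x})
  map_h₁ : ∀ t v, ψ (DVS.h₁ t v) = E.h₁ t (ψ v)
  map_h₂ : ∀ t v, ψ (DVS.h₂ t v) = E.h₂ t (ψ v)

/-- `ε` exhibits the principal bundle `Q` as the frame bundle of `E`: for each `x`, the fibre of `Q`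
over `x` is in bijection, by `p ↦ ε p`, with the set of frames of `E` at `x`; the group acts by
`ψ ↦ ψ ∘ g`; and frames depend smoothly on the point of `Q`. -/
structure IsFrameBundle (E : DoubleVectorBundle n M d d' d₀) (Q : DVPrincipal n M d d' d₀)
    (ε : Q.Total → DVS d d' d₀ → E.Total) : Prop where
  isFrame : ∀ p, IsFrame E (Q.proj p) (ε p)
  existsUnique : ∀ x ψ, IsFrame E x ψ → ∃! p, Q.proj p = x ∧ ε p = ψ
  act : ∀ p g v, ε (Q.act p g) v = ε p (g • v)
  contMDiff : ContMDiff (((𝓡 n).prod (DVAutI d d' d₀)).prod 𝓘(ℝ, DVS d d' d₀))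
    ((𝓡 n).prod 𝓘(ℝ, DVS d d' d₀)) ∞ (fun z : Q.Total × DVS d d' d₀ => ε z.1 z.2)

end DVB

end

noncomputable section

/-! ### The automorphism group of a double vector space -/

/-! The two families of homotheties rigidify smooth maps. If `f` is a differentiable self-map of the
double vector space commuting with both, then putting `t = 0` shows that its first component depends
on `y` alone and its second on `y'` alone. A differentiable map homogeneous of degree one equals its
derivative at `0`, so these two components are linear, while the third is linear in `(y, z)` for
fixed `y'` and in `(y', z)` for fixed `y`; hence it has the form `β (y, y') + σ z`. Injectivity of
`f` makes the three linear parts invertible. This is `DVAut.exists_smul_eq_of_commute`; it gives the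
description of the group, and it does not ask for a smooth inverse.

It follows that a frame read in a local trivialization of `E` is a single element of the group, so
the frames over a trivializing open set `U` form `U × 𝔾`. Conversely, a local section of `P` over
`U` identifies the associated bundle over `U` with `U × ℝ^{(d,d',d₀)}`. Both total spaces are thus
sets with local coordinates over `M` and smooth coordinate changes, and `FiberAtlas` turns such data
into a manifold once for both. Smoothness into the group is tested on vectors, by
`DVAut.contMDiffAt_of_smul`; smoothness out of the associated bundle is tested upstairs, by
`PrincipalBundle.contMDiff_of_comp_assocQ`, since the quotient map has local sections.

For the equivalence, a morphism of principal bundles is fibrewise a map of torsors, hence invertible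
(`PrincipalBundle.Hom.symm`). Therefore the associated bundle functor lands in the core, and the
unit need only be constructed as a morphism. The counit is a bijection, with inverse smooth because
local smooth frames exist. Naturality and the triangle identity are checked on representatives `[p,
v]`. -/

theorem eq_fderiv_of_homogeneous {E F : Type*} [NormedAddCommGroup E] [NormedSpace ℝ E]
    [NormedAddCommGroup F] [NormedSpace ℝ F] {f : E → F} (hf : DifferentiableAt ℝ f 0)
    (h : ∀ (t : ℝ) y, f (t • y) = t • f y) (y : E) : f y = fderiv ℝ f 0 y := by
  -- The curve `t ↦ f (t • y)` is differentiated at `0` twice: by the chain rule, and as the line `t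
  -- • f y`.
  have h1 : HasDerivAt (fun t : ℝ => f (t • y)) (fderiv ℝ f 0 y) 0 := by
    have h2 : HasDerivAt (fun t : ℝ => t • y) y 0 := by
      simpa using (hasDerivAt_id (0 : ℝ)).smul_const y
    have h3 : HasFDerivAt f (fderiv ℝ f 0) ((0 : ℝ) • y) := by
      rw [zero_smul]; exact hf.hasFDerivAt
    exact h3.comp_hasDerivAt (0 : ℝ) h2
  have h4 : HasDerivAt (fun t : ℝ => f (t • y)) (f y) 0 := by
    simp only [h]
    simpa using (hasDerivAt_id (0 : ℝ)).smul_const (f y)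
  exact h4.unique h1

/-- An injective continuous linear endomorphism of `ℝ^k`, as a unit. -/
theorem exists_unit_of_injective {k : ℕ} (a : DVEnd k) (ha : Function.Injective a) :
    ∃ u : (DVEnd k)ˣ, (u : DVEnd k) = a := by
  let e := (LinearEquiv.ofInjectiveEndo (a : (Fin k → ℝ) →ₗ[ℝ] (Fin k → ℝ)) ha)
  let e' := e.toContinuousLinearEquiv
  refine ⟨ContinuousLinearEquiv.unitsEquiv ℝ (Fin k → ℝ) |>.symm e', ?_⟩
  ext1 v
  rfl

namespace DVAut

variable {d d' d₀ : ℕ}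

theorem smul_h₁ (g : DVAut d d' d₀) (t : ℝ) (v : DVS d d' d₀) :
    g • DVS.h₁ t v = DVS.h₁ t (g • v) := by
  simp [smul_def, DVS.h₁]

theorem smul_h₂ (g : DVAut d d' d₀) (t : ℝ) (v : DVS d d' d₀) :
    g • DVS.h₂ t v = DVS.h₂ t (g • v) := by
  simp [smul_def, DVS.h₂]

/-- The action is faithful: the vectors `(y, 0, 0)`, `(0, y', 0)`, `(0, 0, z)` and `(y, y', 0)` read
off the four components. -/
theorem eq_of_smul_eq {g h : DVAut d d' d₀} (H : ∀ v : DVS d d' d₀, g • v = h • v) : g = h := by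
  ext1
  · ext1; refine ContinuousLinearMap.ext fun y => ?_
    exact congrArg Prod.fst (H (y, 0, 0))
  · ext1; refine ContinuousLinearMap.ext fun y => ?_
    exact congrArg (fun v => v.2.1) (H (0, y, 0))
  · ext1; refine ContinuousLinearMap.ext fun y => ?_
    simpa [smul_def] using congrArg (fun v => v.2.2) (H (0, 0, y))
  · refine ContinuousLinearMap.ext fun y => ContinuousLinearMap.ext fun y' => ?_
    simpa [smul_def] using congrArg (fun v => v.2.2) (H (y, y', 0))

/-- A differentiable injective map commuting with both families of homotheties is given by an
element of the automorphism group. -/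
theorem exists_smul_eq_of_commute {f : DVS d d' d₀ → DVS d d' d₀} (hf : Differentiable ℝ f)
    (hinj : Function.Injective f) (H₁ : ∀ t v, f (DVS.h₁ t v) = DVS.h₁ t (f v))
    (H₂ : ∀ t v, f (DVS.h₂ t v) = DVS.h₂ t (f v)) :
    ∃ g : DVAut d d' d₀, ∀ v, f v = g • v := by
  have a1 (t : ℝ) y y' z : (f (t • y, y', t • z)).1 = t • (f (y, y', z)).1 :=
    congrArg Prod.fst (H₁ t (y, y', z))
  have a2 (t : ℝ) y y' z : (f (y, t • y', t • z)).1 = (f (y, y', z)).1 := by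
    have := congrArg Prod.fst (H₂ t (y, y', z))
    exact this
  have b1 (t : ℝ) y y' z : (f (t • y, y', t • z)).2.1 = (f (y, y', z)).2.1 :=
    congrArg (fun v => v.2.1) (H₁ t (y, y', z))
  have b2 (t : ℝ) y y' z : (f (y, t • y', t • z)).2.1 = t • (f (y, y', z)).2.1 :=
    congrArg (fun v => v.2.1) (H₂ t (y, y', z))
  have c1 (t : ℝ) y y' z : (f (t • y, y', t • z)).2.2 = t • (f (y, y', z)).2.2 :=
    congrArg (fun v => v.2.2) (H₁ t (y, y', z))
  have c2 (t : ℝ) y y' z : (f (y, t • y', t • z)).2.2 = t • (f (y, y', z)).2.2 :=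
    congrArg (fun v => v.2.2) (H₂ t (y, y', z))
  -- The case `t = 0` of `a2` replaces `y'` and `z` by `0`; what remains is homogeneous in `y` by
  -- `a1`.
  obtain ⟨A, hA⟩ : ∃ A : DVEnd d, ∀ v, (f v).1 = A v.1 := by
    refine ⟨fderiv ℝ (fun y : Fin d → ℝ => (f (y, 0, 0)).1) 0, fun v => ?_⟩
    rw [← eq_fderiv_of_homogeneous (f := fun y : Fin d → ℝ => (f (y, 0, 0)).1)]
    · have := a2 0 v.1 v.2.1 v.2.2
      simp only [zero_smul] at this
      exact this.symm
    · exact (by fun_prop : Differentiable ℝ fun y : Fin d → ℝ => (f (y, 0, 0)).1) 0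
    · intro t y
      have := a1 t y 0 0
      rwa [smul_zero] at this
  obtain ⟨A', hA'⟩ : ∃ A : DVEnd d', ∀ v, (f v).2.1 = A v.2.1 := by
    refine ⟨fderiv ℝ (fun y : Fin d' → ℝ => (f (0, y, 0)).2.1) 0, fun v => ?_⟩
    rw [← eq_fderiv_of_homogeneous (f := fun y : Fin d' → ℝ => (f (0, y, 0)).2.1)]
    · have := b1 0 v.1 v.2.1 v.2.2
      simp only [zero_smul] at this
      exact this.symm
    · exact (by fun_prop : Differentiable ℝ fun y : Fin d' → ℝ => (f (0, y, 0)).2.1) 0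
    · intro t y
      have := b2 t 0 y 0
      rwa [smul_zero] at this
  -- With `y'` frozen, `h₁` is scalar multiplication on the pair `(y, z)`, so homogeneity gives
  -- joint linearity in that pair. `L2` is the symmetric statement.
  have L1 (y' : Fin d' → ℝ) : ∃ L : (Fin d → ℝ) × (Fin d₀ → ℝ) →L[ℝ] (Fin d₀ → ℝ),
      ∀ y z, (f (y, y', z)).2.2 = L (y, z) := by
    refine ⟨fderiv ℝ (fun w : (Fin d → ℝ) × (Fin d₀ → ℝ) => (f (w.1, y', w.2)).2.2) 0,
      fun y z => ?_⟩
    rw [← eq_fderiv_of_homogeneous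
      (f := fun w : (Fin d → ℝ) × (Fin d₀ → ℝ) => (f (w.1, y', w.2)).2.2)]
    · exact (by fun_prop : Differentiable ℝ
        fun w : (Fin d → ℝ) × (Fin d₀ → ℝ) => (f (w.1, y', w.2)).2.2) 0
    · exact fun t w => c1 t w.1 y' w.2
  have L2 (y : Fin d → ℝ) : ∃ L : (Fin d' → ℝ) × (Fin d₀ → ℝ) →L[ℝ] (Fin d₀ → ℝ),
      ∀ y' z, (f (y, y', z)).2.2 = L (y', z) := by
    refine ⟨fderiv ℝ (fun w : (Fin d' → ℝ) × (Fin d₀ → ℝ) => (f (y, w.1, w.2)).2.2) 0,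
      fun y' z => ?_⟩
    rw [← eq_fderiv_of_homogeneous
      (f := fun w : (Fin d' → ℝ) × (Fin d₀ → ℝ) => (f (y, w.1, w.2)).2.2)]
    · exact (by fun_prop : Differentiable ℝ
        fun w : (Fin d' → ℝ) × (Fin d₀ → ℝ) => (f (y, w.1, w.2)).2.2) 0
    · exact fun t w => c2 t y w.1 w.2
  choose L hL using L1
  choose L' hL' using L2
  let B₀ : (Fin d → ℝ) →ₗ[ℝ] (Fin d' → ℝ) →ₗ[ℝ] (Fin d₀ → ℝ) :=
    LinearMap.mk₂ ℝ (fun y y' => (f (y, y', 0)).2.2)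
      (fun y₁ y₂ y' => by
        simp only [hL, ← map_add, Prod.mk_add_mk, add_zero])
      (fun c y y' => by
        simp only [hL, ← map_smul, Prod.smul_mk, smul_zero])
      (fun y y'₁ y'₂ => by
        simp only [hL', ← map_add, Prod.mk_add_mk, add_zero])
      (fun c y y' => by
        simp only [hL', ← map_smul, Prod.smul_mk, smul_zero])
  let B : DVBil d d' d₀ :=
    LinearMap.toContinuousLinearMap
      ((LinearMap.toContinuousLinearMap : ((Fin d' → ℝ) →ₗ[ℝ] (Fin d₀ → ℝ)) ≃ₗ[ℝ] _).toLinearMap ∘ₗ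
        B₀)
  have hB y y' : B y y' = (f (y, y', 0)).2.2 := rfl
  let S : DVEnd d₀ := (L 0).comp (ContinuousLinearMap.inr ℝ _ _)
  have hS z : S z = (f (0, 0, z)).2.2 := (hL 0 0 z).symm
  have hf3 (v) : (f v).2.2 = B v.1 v.2.1 + S v.2.2 := by
    obtain ⟨y, y', z⟩ := v
    simp only [hB, hS]
    -- Additivity in `(y, z)`, then in `(y', z)`, splits off the bilinear term and the term in `z`;
    -- the leftover value at `(0, y', 0)` vanishes by homogeneity with `t = 0`.
    have e1 : (f (y, y', z)).2.2 = (f (y, y', 0)).2.2 + (f (0, y', z)).2.2 := by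
      simp only [hL, ← map_add, Prod.mk_add_mk, add_zero, zero_add]
    have e2 : (f (0, y', z)).2.2 = (f (0, y', 0)).2.2 + (f (0, 0, z)).2.2 := by
      simp only [hL', ← map_add, Prod.mk_add_mk, add_zero, zero_add]
    have e3 : (f (0, y', 0)).2.2 = 0 := by
      simpa using c1 0 0 y' 0
    rw [e1, e2, e3, zero_add]
  have hfv (v) : f v = (A v.1, A' v.2.1, B v.1 v.2.1 + S v.2.2) :=
    Prod.ext (hA v) (Prod.ext (hA' v) (hf3 v))
  -- On each coordinate axis the bilinear term vanishes and `f` is the corresponding linear part,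
  -- which inherits injectivity.
  obtain ⟨a, rfl⟩ := exists_unit_of_injective A fun y₁ y₂ h => by
    have : f (y₁, 0, 0) = f (y₂, 0, 0) := by simp [hfv, h]
    exact congrArg Prod.fst (hinj this)
  obtain ⟨a', rfl⟩ := exists_unit_of_injective A' fun y₁ y₂ h => by
    have : f (0, y₁, 0) = f (0, y₂, 0) := by simp [hfv, h]
    exact congrArg (fun v => v.2.1) (hinj this)
  obtain ⟨s, hs⟩ := exists_unit_of_injective S fun y₁ y₂ h => by
    have : f (0, 0, y₁) = f (0, 0, y₂) := by simp [hfv, h]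
    exact congrArg (fun v => v.2.2) (hinj this)
  rw [← hs] at hfv
  exact ⟨(a, a', s, B), hfv⟩

/-! ### Smooth maps into and out of the automorphism group -/

section Smooth

variable {EN HN : Type*} [NormedAddCommGroup EN] [NormedSpace ℝ EN] [TopologicalSpace HN]
  {IN : ModelWithCorners ℝ EN HN} {N : Type*} [TopologicalSpace N] [ChartedSpace HN N]

theorem contMDiff_α : ContMDiff (DVAutI d d' d₀) 𝓘(ℝ, DVEnd d) ∞
    (α : DVAut d d' d₀ → (DVEnd d)ˣ) :=
  contMDiff_fst (N := (DVEnd d')ˣ × (DVEnd d₀)ˣ × DVBil d d' d₀)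

theorem contMDiff_snd_DVAut : ContMDiff (DVAutI d d' d₀)
    (𝓘(ℝ, DVEnd d').prod (𝓘(ℝ, DVEnd d₀).prod 𝓘(ℝ, DVBil d d' d₀))) ∞
    (fun g : DVAut d d' d₀ => (g.2 : (DVEnd d')ˣ × (DVEnd d₀)ˣ × DVBil d d' d₀)) :=
  contMDiff_snd (M := (DVEnd d)ˣ) (N := (DVEnd d')ˣ × (DVEnd d₀)ˣ × DVBil d d' d₀)

theorem contMDiff_α' : ContMDiff (DVAutI d d' d₀) 𝓘(ℝ, DVEnd d') ∞
    (α' : DVAut d d' d₀ → (DVEnd d')ˣ) :=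
  contMDiff_fst.comp contMDiff_snd_DVAut

theorem contMDiff_σ : ContMDiff (DVAutI d d' d₀) 𝓘(ℝ, DVEnd d₀) ∞
    (σ : DVAut d d' d₀ → (DVEnd d₀)ˣ) :=
  contMDiff_fst.comp (contMDiff_snd.comp contMDiff_snd_DVAut)

theorem contMDiff_β : ContMDiff (DVAutI d d' d₀) 𝓘(ℝ, DVBil d d' d₀) ∞
    (β : DVAut d d' d₀ → DVBil d d' d₀) :=
  contMDiff_snd.comp (contMDiff_snd.comp contMDiff_snd_DVAut)

theorem contMDiffAt_of_components {g : N → DVAut d d' d₀} {x : N}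
    (h1 : ContMDiffAt IN 𝓘(ℝ, DVEnd d) ∞ (fun n => (g n).α) x)
    (h2 : ContMDiffAt IN 𝓘(ℝ, DVEnd d') ∞ (fun n => (g n).α') x)
    (h3 : ContMDiffAt IN 𝓘(ℝ, DVEnd d₀) ∞ (fun n => (g n).σ) x)
    (h4 : ContMDiffAt IN 𝓘(ℝ, DVBil d d' d₀) ∞ (fun n => (g n).β) x) :
    ContMDiffAt IN (DVAutI d d' d₀) ∞ g x :=
  h1.prodMk (h2.prodMk (h3.prodMk h4))

/-- The units are open in `R`, and their chart is the inclusion. -/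
theorem contMDiffAt_units_of_val {R : Type*} [NormedRing R] [NormedAlgebra ℝ R] [CompleteSpace R]
    {a : N → Rˣ} {x : N} (h : ContMDiffAt IN 𝓘(ℝ, R) ∞ (fun n => (a n : R)) x) :
    ContMDiffAt IN 𝓘(ℝ, R) ∞ a x := by
  have hc : ContinuousAt a x := Units.isOpenEmbedding_val.isInducing.continuousAt_iff.2 h.continuousAt
  rw [contMDiffAt_iff_target]
  exact ⟨hc, h⟩

/-- A linear map on `ℝ^k` is a fixed linear expression in its values on the standard basis. -/
theorem contMDiffAt_clm_of_apply {k : ℕ} {F : Type*} [NormedAddCommGroup F] [NormedSpace ℝ F]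
    {a : N → (Fin k → ℝ) →L[ℝ] F} {x : N}
    (h : ∀ v, ContMDiffAt IN 𝓘(ℝ, F) ∞ (fun n => a n v) x) :
    ContMDiffAt IN 𝓘(ℝ, (Fin k → ℝ) →L[ℝ] F) ∞ a x := by
  have key (b : (Fin k → ℝ) →L[ℝ] F) : b = ∑ i, ContinuousLinearMap.smulRightL ℝ (Fin k → ℝ) F
      (ContinuousLinearMap.proj i) (b (Pi.single i 1)) := by
    refine ContinuousLinearMap.ext fun w => ?_
    conv_lhs => rw [← Finset.univ_sum_single w, map_sum]
    simp [← map_smul, ← Pi.single_smul]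
  have : a = fun n => ∑ i, ContinuousLinearMap.smulRightL ℝ (Fin k → ℝ) F
      (ContinuousLinearMap.proj i) (a n (Pi.single i 1)) := funext fun n => key _
  rw [this]
  refine contMDiffAt_finsetSum fun i _ => ?_
  exact ((ContinuousLinearMap.smulRightL ℝ (Fin k → ℝ) F
    (ContinuousLinearMap.proj i)).contMDiff.contMDiffAt).comp x (h _)

/-- A map into the automorphism group is smooth if its action on each vector is. -/
theorem contMDiffAt_of_smul {g : N → DVAut d d' d₀} {x : N}
    (h : ∀ v : DVS d d' d₀, ContMDiffAt IN 𝓘(ℝ, DVS d d' d₀) ∞ (fun n => g n • v) x) :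
    ContMDiffAt IN (DVAutI d d' d₀) ∞ g x := by
  have c1 (v : DVS d d' d₀) : ContMDiffAt IN 𝓘(ℝ, Fin d → ℝ) ∞ (fun n => (g n • v).1) x :=
    contDiff_fst.comp_contMDiffAt (h v)
  have c2 (v : DVS d d' d₀) : ContMDiffAt IN 𝓘(ℝ, Fin d' → ℝ) ∞ (fun n => (g n • v).2.1) x :=
    (contDiff_fst.comp contDiff_snd).comp_contMDiffAt (h v)
  have c3 (v : DVS d d' d₀) : ContMDiffAt IN 𝓘(ℝ, Fin d₀ → ℝ) ∞ (fun n => (g n • v).2.2) x :=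
    (contDiff_snd.comp contDiff_snd).comp_contMDiffAt (h v)
  refine contMDiffAt_of_components ?_ ?_ ?_ ?_
  · exact contMDiffAt_units_of_val (contMDiffAt_clm_of_apply fun y => c1 (y, 0, 0))
  · exact contMDiffAt_units_of_val (contMDiffAt_clm_of_apply fun y => c2 (0, y, 0))
  · refine contMDiffAt_units_of_val (contMDiffAt_clm_of_apply fun y => ?_)
    simpa [smul_def] using c3 (0, 0, y)
  · refine contMDiffAt_clm_of_apply fun y => contMDiffAt_clm_of_apply fun y' => ?_
    simpa [smul_def] using c3 (y, y', 0)

theorem contMDiff_smul : ContMDiff ((DVAutI d d' d₀).prod 𝓘(ℝ, DVS d d' d₀)) 𝓘(ℝ, DVS d d' d₀) ∞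
    (fun z : DVAut d d' d₀ × DVS d d' d₀ => z.1 • z.2) := by
  have v : ContMDiff ((DVAutI d d' d₀).prod 𝓘(ℝ, DVS d d' d₀)) 𝓘(ℝ, DVS d d' d₀) ∞
    (fun z : DVAut d d' d₀ × DVS d d' d₀ => z.2) := contMDiff_snd
  have v1 := contDiff_fst.comp_contMDiff v
  have v2 := (contDiff_fst.comp contDiff_snd).comp_contMDiff v
  have v3 := (contDiff_snd.comp contDiff_snd).comp_contMDiff v
  have p : ContMDiff ((DVAutI d d' d₀).prod 𝓘(ℝ, DVS d d' d₀)) (DVAutI d d' d₀) ∞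
    (fun z : DVAut d d' d₀ × DVS d d' d₀ => z.1) := contMDiff_fst
  have p1 := (Units.contMDiff_val (𝕜 := ℝ)).comp (contMDiff_α.comp p)
  have p2 := (Units.contMDiff_val (𝕜 := ℝ)).comp (contMDiff_α'.comp p)
  have p3 := (Units.contMDiff_val (𝕜 := ℝ)).comp (contMDiff_σ.comp p)
  have p4 := contMDiff_β.comp p
  exact (p1.clm_apply v1).prodMk_space ((p2.clm_apply v2).prodMk_space
    (((p4.clm_apply v1).clm_apply v2).add (p3.clm_apply v3)))

theorem _root_.ContMDiffAt.dvAut_smul {g : N → DVAut d d' d₀} {w : N → DVS d d' d₀} {x : N}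
    (hg : ContMDiffAt IN (DVAutI d d' d₀) ∞ g x)
    (hw : ContMDiffAt IN 𝓘(ℝ, DVS d d' d₀) ∞ w x) :
    ContMDiffAt IN 𝓘(ℝ, DVS d d' d₀) ∞ (fun n => g n • w n) x :=
  (contMDiff_smul.contMDiffAt (x := (g x, w x))).comp x (hg.prodMk hw)

end Smooth

/-! ### The Lie group structure and the double principal group -/

instance : IsManifold (DVAutI d d' d₀) ∞ (DVAut d d' d₀) :=
  inferInstanceAs (IsManifold (DVAutI d d' d₀) ∞
    ((DVEnd d)ˣ × (DVEnd d')ˣ × (DVEnd d₀)ˣ × DVBil d d' d₀))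

/-- Reduces smoothness of inversion in the group to inversion in the three unit groups, through the
explicit bilinear part of the inverse. -/
theorem contMDiffAt_inv_smul (v : DVS d d' d₀) (g : DVAut d d' d₀) :
    ContMDiffAt (DVAutI d d' d₀) 𝓘(ℝ, DVS d d' d₀) ∞ (fun g : DVAut d d' d₀ => g⁻¹ • v) g := by
  have q1 := (Units.contMDiff_val (𝕜 := ℝ)).comp
    ((contMDiff_inv 𝓘(ℝ, DVEnd d) ∞).comp (contMDiff_α (d := d) (d' := d') (d₀ := d₀)))
  have q2 := (Units.contMDiff_val (𝕜 := ℝ)).comp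
    ((contMDiff_inv 𝓘(ℝ, DVEnd d') ∞).comp (contMDiff_α' (d := d) (d' := d') (d₀ := d₀)))
  have q3 := (Units.contMDiff_val (𝕜 := ℝ)).comp
    ((contMDiff_inv 𝓘(ℝ, DVEnd d₀) ∞).comp (contMDiff_σ (d := d) (d' := d') (d₀ := d₀)))
  have w1 := q1.clm_apply (contMDiff_const (c := v.1))
  have w2 := q2.clm_apply (contMDiff_const (c := v.2.1))
  have w3 := q3.clm_apply (contMDiff_const (c := v.2.2))
  exact (w1.prodMk_space (w2.prodMk_space
    ((q3.clm_apply ((contMDiff_β.clm_apply w1).clm_apply w2)).neg.add w3))).contMDiffAt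

instance : LieGroup (DVAutI d d' d₀) ∞ (DVAut d d' d₀) where
  contMDiff_mul := fun z => contMDiffAt_of_smul fun v => by
    simp only [mul_smul]
    exact contMDiffAt_fst.dvAut_smul (contMDiffAt_snd.dvAut_smul contMDiffAt_const)
  contMDiff_inv := fun g => contMDiffAt_of_smul fun v => contMDiffAt_inv_smul v g

instance : T2Space (DVAut d d' d₀) :=
  inferInstanceAs (T2Space ((DVEnd d)ˣ × (DVEnd d')ˣ × (DVEnd d₀)ˣ × DVBil d d' d₀))

instance : SecondCountableTopology (DVAut d d' d₀) := by
  have (k : ℕ) : SecondCountableTopology (DVEnd k)ˣ :=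
    (Units.isOpenEmbedding_val (R := DVEnd k)).isInducing.secondCountableTopology
  exact inferInstanceAs (SecondCountableTopology
    ((DVEnd d)ˣ × (DVEnd d')ˣ × (DVEnd d₀)ˣ × DVBil d d' d₀))

theorem isDoublePrincipalGroup : IsDoublePrincipalGroup (DVAutI d d' d₀) (DVAut d d' d₀)
    (fixFst d d' d₀) (fixSnd d d' d₀) where
  lieGroup := inferInstance
  t2 := inferInstance
  secondCountable := inferInstance
  normal_left := ⟨fun n (hn : n.α = 1) g => show (g * n * g⁻¹).α = 1 by simp [hn]⟩
  normal_right := ⟨fun n (hn : n.α' = 1) g => show (g * n * g⁻¹).α' = 1 by simp [hn]⟩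
  closed_left := isClosed_eq contMDiff_α.continuous continuous_const
  closed_right := isClosed_eq contMDiff_α'.continuous continuous_const
  generates := by
    rw [eq_top_iff]
    intro g _
    -- The element `a` carries only the part of `g` acting on `y`, so it lies in `fixSnd`, and `g *
    -- a⁻¹` acts trivially on `y`.
    let a : DVAut d d' d₀ := (g.α, 1, 1, 0)
    have ha : a ∈ fixSnd d d' d₀ := rfl
    have hb : g * a⁻¹ ∈ fixFst d d' d₀ := show g.α * g.α⁻¹ = 1 from mul_inv_cancel _
    rw [← inv_mul_cancel_right g a]
    exact mul_mem (Subgroup.subset_closure (Or.inl hb)) (Subgroup.subset_closure (Or.inr ha))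

theorem exists_diffeomorph_iff (f : DVS d d' d₀ → DVS d d' d₀) :
    (∃ φ : Diffeomorph 𝓘(ℝ, DVS d d' d₀) 𝓘(ℝ, DVS d d' d₀) (DVS d d' d₀) (DVS d d' d₀) ∞,
      ⇑φ = f ∧ ∀ t v, f (DVS.h₁ t v) = DVS.h₁ t (f v) ∧ f (DVS.h₂ t v) = DVS.h₂ t (f v)) ↔
    ∃! g : DVAut d d' d₀, ∀ v, f v = g • v := by
  constructor
  · rintro ⟨φ, rfl, h⟩
    obtain ⟨g, hg⟩ := exists_smul_eq_of_commute
      (φ.contMDiff.contDiff.differentiable (by simp)) φ.injective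
      (fun t v => (h t v).1) (fun t v => (h t v).2)
    exact ⟨g, hg, fun g' hg' => eq_of_smul_eq fun v => (hg' v).symm.trans (hg v)⟩
  · rintro ⟨g, hg, -⟩
    have sm (g : DVAut d d' d₀) : ContMDiff 𝓘(ℝ, DVS d d' d₀) 𝓘(ℝ, DVS d d' d₀) ∞
        (fun v : DVS d d' d₀ => g • v) := fun v => contMDiffAt_const.dvAut_smul contMDiffAt_id
    refine ⟨⟨MulAction.toPerm g, sm g, sm g⁻¹⟩, (funext hg).symm, fun t v => ?_⟩
    simp only [hg, smul_h₁, smul_h₂, and_self]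

end DVAut
end

noncomputable section

/-! ### Manifolds from charts with values in a manifold -/

section ChartedOverManifold

variable {EX HX : Type*} [NormedAddCommGroup EX] [NormedSpace ℝ EX] [TopologicalSpace HX]
  (I : ModelWithCorners ℝ EX HX) (X : Type*) [TopologicalSpace X] [ChartedSpace HX X]
  [IsManifold I ∞ X] {E : Type*} [TopologicalSpace E] [ChartedSpace X E]

/-- A composite chart is a chart into `X` followed by a chart of `X`, so a transition map is a
transition in `X`, smooth by hypothesis, between two charts of `X`. -/
theorem isManifold_comp
    (h : ∀ e ∈ atlas X E, ∀ e' ∈ atlas X E, ContMDiffOn I I ∞ (e.symm ≫ₕ e') (e.symm ≫ₕ e').source) :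
    @IsManifold ℝ _ EX _ _ HX _ I ∞ E _ (ChartedSpace.comp HX X E) := by
  let _ := ChartedSpace.comp HX X E
  refine isManifold_of_contDiffOn I ∞ E ?_
  rintro _ _ ⟨e, he, c, hc, rfl⟩ ⟨e', he', c', hc', rfl⟩
  rw [← contMDiffOn_iff_contDiffOn]
  have h1 : ContMDiffOn I I ∞ c.symm c.target :=
    contMDiffOn_symm_of_mem_maximalAtlas (IsManifold.subset_maximalAtlas hc)
  have h2 : ContMDiffOn I I ∞ c' c'.source :=
    contMDiffOn_of_mem_maximalAtlas (IsManifold.subset_maximalAtlas hc')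
  have h3 := I.contMDiff (n := ∞)
  have h4 := I.contMDiffOn_symm (n := ∞)
  refine (h3.comp_contMDiffOn (h2.comp ((h e he e' he').comp (h1.comp (h4.mono ?_) ?_) ?_) ?_))
  · exact Set.inter_subset_right
  all_goals
    intro x hx
    simp only [mfld_simps] at hx ⊢
    tauto

end ChartedOverManifold

/-! ### Local trivializations of smooth fibrations -/

section Fibration

variable {EM HM : Type*} [NormedAddCommGroup EM] [NormedSpace ℝ EM] [TopologicalSpace HM]
  (IM : ModelWithCorners ℝ EM HM) {M : Type u} [TopologicalSpace M] [ChartedSpace HM M]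
  {EF HF : Type*} [NormedAddCommGroup EF] [NormedSpace ℝ EF] [TopologicalSpace HF]
  (IF : ModelWithCorners ℝ EF HF) (F : Type) [TopologicalSpace F] [ChartedSpace HF F]

/-- A smooth local trivialization, with fibre `F`, of the map `proj : E → M`. -/
structure SmoothTriv {E : Type u} [TopologicalSpace E] [ChartedSpace (ModelProd HM HF) E]
    (proj : E → M) where
  base : Set M
  isOpen_base : IsOpen base
  φ : OpenPartialHomeomorph E (M × F)
  source_eq : φ.source = proj ⁻¹' base
  target_eq : φ.target = base ×ˢ Set.univ
  contMDiffOn_φ : ContMDiffOn (IM.prod IF) (IM.prod IF) ∞ φ φ.source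
  contMDiffOn_symm : ContMDiffOn (IM.prod IF) (IM.prod IF) ∞ φ.symm φ.target
  fst_φ : ∀ e ∈ φ.source, (φ e).1 = proj e

namespace SmoothTriv

variable {IM IF F} {E : Type u} [TopologicalSpace E] [ChartedSpace (ModelProd HM HF) E]
  {proj : E → M} (t : SmoothTriv IM IF F proj)

/-- The coordinate in the fibre. -/
def coord (e : E) : F := (t.φ e).2

/-- The point over `x` with fibre coordinate `f`. -/
def point (x : M) (f : F) : E := t.φ.symm (x, f)

variable {t}

theorem mem_source {e : E} (he : proj e ∈ t.base) : e ∈ t.φ.source := by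
  rw [t.source_eq]; exact he

theorem mem_target {x : M} (hx : x ∈ t.base) (f : F) : (x, f) ∈ t.φ.target := by
  rw [t.target_eq]; exact ⟨hx, trivial⟩

theorem φ_apply {e : E} (he : proj e ∈ t.base) : t.φ e = (proj e, t.coord e) :=
  Prod.ext (t.fst_φ e (mem_source he)) rfl

theorem φ_point {x : M} (hx : x ∈ t.base) (f : F) : t.φ (t.point x f) = (x, f) :=
  t.φ.right_inv (mem_target hx f)

theorem proj_point {x : M} (hx : x ∈ t.base) (f : F) : proj (t.point x f) = x := by
  exact (t.fst_φ _ (t.φ.map_target (mem_target hx f))).symm.trans (congrArg Prod.fst (φ_point hx f))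

theorem coord_point {x : M} (hx : x ∈ t.base) (f : F) : t.coord (t.point x f) = f :=
  congrArg Prod.snd (φ_point hx f)

theorem point_coord {e : E} (he : proj e ∈ t.base) : t.point (proj e) (t.coord e) = e := by
  rw [point, ← φ_apply he]
  exact t.φ.left_inv (mem_source he)

theorem ext_of_coord {e e' : E} (he : proj e ∈ t.base) (h : proj e' = proj e)
    (hc : t.coord e' = t.coord e) : e' = e := by
  rw [← point_coord he, ← point_coord (t := t) (e := e') (h ▸ he), h, hc]

theorem contMDiffAt_coord {e : E} (he : proj e ∈ t.base) :
    ContMDiffAt (IM.prod IF) IF ∞ t.coord e :=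
  contMDiffAt_snd.comp e
    (t.contMDiffOn_φ.contMDiffAt (t.φ.open_source.mem_nhds (mem_source he)))

theorem contMDiffAt_proj {e : E} (he : proj e ∈ t.base) :
    ContMDiffAt (IM.prod IF) IM ∞ proj e := by
  have h := t.φ.open_source.mem_nhds (mem_source he)
  refine (contMDiffAt_fst.comp e (t.contMDiffOn_φ.contMDiffAt h)).congr_of_eventuallyEq ?_
  filter_upwards [h] with e' he' using (t.fst_φ e' he').symm

theorem contMDiffAt_point {x : M} (hx : x ∈ t.base) (f : F) :
    ContMDiffAt (IM.prod IF) (IM.prod IF) ∞ (fun z : M × F => t.point z.1 z.2) (x, f) :=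
  t.contMDiffOn_symm.contMDiffAt (t.φ.open_target.mem_nhds (mem_target hx f))

section Maps

variable {EN HN : Type*} [NormedAddCommGroup EN] [NormedSpace ℝ EN] [TopologicalSpace HN]
  {IN : ModelWithCorners ℝ EN HN} {N : Type*} [TopologicalSpace N] [ChartedSpace HN N]

theorem contMDiffAt_point_comp {a : N → M} {b : N → F} {y : N} (hy : a y ∈ t.base)
    (ha : ContMDiffAt IN IM ∞ a y) (hb : ContMDiffAt IN IF ∞ b y) :
    ContMDiffAt IN (IM.prod IF) ∞ (fun n => t.point (a n) (b n)) y :=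
  (contMDiffAt_point hy (b y)).comp y (ha.prodMk hb)

/-- A map into the total space is smooth if its two coordinates are. -/
theorem contMDiffAt_of_coord {h : N → E} {y : N} (hy : proj (h y) ∈ t.base)
    (ha : ContMDiffAt IN IM ∞ (fun n => proj (h n)) y)
    (hb : ContMDiffAt IN IF ∞ (fun n => t.coord (h n)) y) :
    ContMDiffAt IN (IM.prod IF) ∞ h y := by
  refine (contMDiffAt_point_comp (a := fun n => proj (h n)) hy ha hb).congr_of_eventuallyEq ?_
  filter_upwards [ha.continuousAt.preimage_mem_nhds (t.isOpen_base.mem_nhds hy)] with n hn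
  exact (point_coord hn).symm

end Maps

end SmoothTriv

/-! ### Gluing a smooth fibration -/

/-- Local trivializations, with fibre `F` and smooth coordinate changes, of a set over `M`. -/
structure FiberAtlas (M : Type u) [TopologicalSpace M] [ChartedSpace HM M] where
  Total : Type u
  proj : Total → M
  -- The trivializations are indexed by the points of `M`, the one at `i` being defined near `i`.
  -- The values of `coord` and `point` off `base i` are unconstrained.
  base : M → Set M
  isOpen_base : ∀ x, IsOpen (base x)
  mem_base : ∀ x, x ∈ base x
  coord : M → Total → F
  point : M → M → F → Total
  proj_point : ∀ i x f, x ∈ base i → proj (point i x f) = x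
  coord_point : ∀ i x f, x ∈ base i → coord i (point i x f) = f
  point_coord : ∀ i e, proj e ∈ base i → point i (proj e) (coord i e) = e
  contMDiffAt_coord_point : ∀ i j x f, x ∈ base i → x ∈ base j →
    ContMDiffAt (IM.prod IF) IF ∞ (fun z : M × F => coord j (point i z.1 z.2)) (x, f)

namespace FiberAtlas

variable {IM IF F} (A : FiberAtlas IM IF F M)

theorem continuousAt_coord_point {i j x} (f : F) (hi : x ∈ A.base i) (hj : x ∈ A.base j) :
    ContinuousAt (fun z : M × F => A.coord j (A.point i z.1 z.2)) (x, f) :=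
  (A.contMDiffAt_coord_point i j x f hi hj).continuousAt

theorem isOpen_overlap (i j : M) :
    IsOpen ((A.base i ∩ A.base j) ×ˢ (Set.univ : Set F)) :=
  ((A.isOpen_base i).inter (A.isOpen_base j)).prod isOpen_univ

theorem continuousOn_coordChange (i j : M) :
    ContinuousOn (fun z : M × F => (z.1, A.coord j (A.point i z.1 z.2)))
      ((A.base i ∩ A.base j) ×ˢ Set.univ) := fun z hz =>
  (continuousAt_fst.prodMk (A.continuousAt_coord_point z.2 hz.1.1 hz.1.2)).continuousWithinAt

theorem contMDiffOn_coordChange (i j : M) :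
    ContMDiffOn (IM.prod IF) (IM.prod IF) ∞
      (fun z : M × F => (z.1, A.coord j (A.point i z.1 z.2)))
      ((A.base i ∩ A.base j) ×ˢ Set.univ) := fun z hz =>
  (contMDiffAt_fst.prodMk (A.contMDiffAt_coord_point i j z.1 z.2 hz.1.1 hz.1.2)).contMDiffWithinAt

/-- This is the final topology for the local parametrizations `point i` on `base i × F`. -/
instance : TopologicalSpace A.Total where
  IsOpen s := ∀ i, IsOpen {z : M × F | z.1 ∈ A.base i ∧ A.point i z.1 z.2 ∈ s}
  isOpen_univ i := by
    simp only [Set.mem_univ, and_true]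
    exact (A.isOpen_base i).preimage continuous_fst
  isOpen_inter s t hs ht i := by
    convert (hs i).inter (ht i) using 1
    ext z
    simp only [Set.mem_inter_iff, Set.mem_ofPred_eq]
    tauto
  isOpen_sUnion S hS i := by
    convert isOpen_biUnion fun s hs => hS s hs i using 1
    ext z
    simp only [Set.mem_sUnion, Set.mem_iUnion, Set.mem_ofPred_eq]
    exact ⟨fun ⟨h, s, hs, hz⟩ => ⟨s, hs, h, hz⟩, fun ⟨s, hs, h, hz⟩ => ⟨h, s, hs, hz⟩⟩

theorem continuous_proj : Continuous A.proj := by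
  refine ⟨fun U hU i => ?_⟩
  convert ((A.isOpen_base i).inter hU).preimage (continuous_fst (Y := F)) using 1
  ext z
  simp only [Set.mem_preimage, Set.mem_inter_iff, Set.mem_ofPred_eq]
  exact and_congr_right fun h => by rw [A.proj_point i _ _ h]

/-- The local trivialization at `i`, as a homeomorphism. -/
def homeo (i : M) : OpenPartialHomeomorph A.Total (M × F) where
  toFun e := (A.proj e, A.coord i e)
  invFun z := A.point i z.1 z.2
  source := A.proj ⁻¹' A.base i
  target := A.base i ×ˢ Set.univ
  map_source' e he := ⟨he, trivial⟩
  map_target' z hz := by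
    rw [Set.mem_preimage, A.proj_point i _ _ hz.1]; exact hz.1
  left_inv' e he := A.point_coord i e he
  right_inv' z hz := Prod.ext (A.proj_point i _ _ hz.1) (A.coord_point i _ _ hz.1)
  open_source := (A.isOpen_base i).preimage A.continuous_proj
  open_target := (A.isOpen_base i).prod isOpen_univ
  continuousOn_toFun := by
    rw [continuousOn_open_iff ((A.isOpen_base i).preimage A.continuous_proj)]
    intro O hO j
    -- Openness is tested in the parametrization at `j`, where the trivialization at `i` becomes the
    -- coordinate change from `j` to `i`.
    convert (A.continuousOn_coordChange j i).isOpen_inter_preimage (A.isOpen_overlap j i) hO using 1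
    ext z
    simp only [Set.mem_inter_iff, Set.mem_preimage, Set.mem_ofPred_eq, Set.mem_prod, Set.mem_univ,
      and_true, and_assoc]
    exact and_congr_right fun h => by rw [A.proj_point j _ _ h]
  continuousOn_invFun := by
    rw [continuousOn_open_iff ((A.isOpen_base i).prod isOpen_univ)]
    intro s hs
    convert hs i using 1
    ext z
    simp

/-- The total space is covered by charts with values in `M × F`. -/
@[reducible] def chartedProd : ChartedSpace (M × F) A.Total where
  atlas := Set.range A.homeo
  chartAt e := A.homeo (A.proj e)
  mem_chart_source _ := A.mem_base _
  chart_mem_atlas _ := ⟨_, rfl⟩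

instance : ChartedSpace (ModelProd HM HF) A.Total :=
  letI := A.chartedProd
  ChartedSpace.comp (ModelProd HM HF) (M × F) A.Total

theorem trans_mem_atlas (i : M) {c : OpenPartialHomeomorph (M × F) (ModelProd HM HF)}
    (hc : c ∈ atlas (ModelProd HM HF) (M × F)) :
    A.homeo i ≫ₕ c ∈ atlas (ModelProd HM HF) A.Total :=
  ⟨_, ⟨i, rfl⟩, c, hc, rfl⟩

/-- Two points of one fibre lie in a common trivialization and are separated there; points of
different fibres are separated in the base. -/
instance [T2Space M] [T2Space F] : T2Space A.Total where
  t2 e e' hne := by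
    by_cases h : A.proj e = A.proj e'
    · let φ := A.homeo (A.proj e)
      have he : e ∈ φ.source := A.mem_base _
      have he' : e' ∈ φ.source := by
        change A.proj e' ∈ A.base (A.proj e)
        rw [← h]; exact A.mem_base _
      obtain ⟨U, V, hU, hV, h1, h2, hd⟩ := t2_separation fun hφ => hne (φ.injOn he he' hφ)
      refine ⟨φ.source ∩ φ ⁻¹' U, φ.source ∩ φ ⁻¹' V, φ.isOpen_inter_preimage hU,
        φ.isOpen_inter_preimage hV, ⟨he, h1⟩, ⟨he', h2⟩, ?_⟩
      exact (hd.preimage φ).mono Set.inter_subset_right Set.inter_subset_right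
    · obtain ⟨U, V, hU, hV, h1, h2, hd⟩ := t2_separation h
      exact ⟨_, _, hU.preimage A.continuous_proj, hV.preimage A.continuous_proj, h1, h2,
        hd.preimage _⟩

/-- Countably many of the sets `base i` cover `M`, and over each the total space is homeomorphic to
an open subset of `M × F`. -/
instance [SecondCountableTopology M] [SecondCountableTopology F] :
    SecondCountableTopology A.Total := by
  obtain ⟨s, hs, hsU⟩ := TopologicalSpace.countable_cover_nhds (f := A.base)
    fun x => (A.isOpen_base x).mem_nhds (A.mem_base x)
  have := hs.to_subtype
  have (i : s) : SecondCountableTopology (A.homeo i).source :=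
    (A.homeo i).toHomeomorphSourceTarget.isInducing.secondCountableTopology
  refine TopologicalSpace.secondCountableTopology_of_countable_cover
    (U := fun i : s => (A.homeo i).source) (fun i => (A.homeo i).open_source) ?_
  refine Set.eq_univ_of_forall fun e => ?_
  have he : A.proj e ∈ ⋃ x ∈ s, A.base x := hsU.symm ▸ Set.mem_univ _
  obtain ⟨i, hi, hei⟩ := Set.mem_iUnion₂.1 he
  exact Set.mem_iUnion.2 ⟨⟨i, hi⟩, hei⟩

/-! ### Smooth structure of the glued space -/

variable [IsManifold IM ∞ M] [IsManifold IF ∞ F]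

instance : IsManifold (IM.prod IF) ∞ A.Total := by
  let _ := A.chartedProd
  refine isManifold_comp (IM.prod IF) (M × F) ?_
  rintro _ ⟨i, rfl⟩ _ ⟨j, rfl⟩
  have hs : ((A.homeo i).symm ≫ₕ A.homeo j).source ⊆
      (A.base i ∩ A.base j) ×ˢ (Set.univ : Set F) := by
    rintro z ⟨hz : z.1 ∈ A.base i ∧ _, hz' : A.proj (A.point i z.1 z.2) ∈ A.base j⟩
    rw [A.proj_point i _ _ hz.1] at hz'
    exact ⟨⟨hz.1, hz'⟩, trivial⟩
  refine ((A.contMDiffOn_coordChange i j).mono hs).congr fun z hz => ?_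
  exact Prod.ext (A.proj_point i _ _ (hs hz).1.1) rfl

/-- The local trivialization at `i`. -/
def triv (i : M) : SmoothTriv IM IF F A.proj where
  base := A.base i
  isOpen_base := A.isOpen_base i
  φ := A.homeo i
  source_eq := rfl
  target_eq := rfl
  fst_φ _ _ := rfl
  contMDiffOn_φ := by
    intro e he
    -- The composite `A.homeo i ≫ₕ c` is a chart of the total space, so near `e` the trivialization
    -- is this chart followed by `c.symm`, both smooth.
    let c := chartAt (ModelProd HM HF) (A.homeo i e)
    have hc : c ∈ atlas (ModelProd HM HF) (M × F) := chart_mem_atlas _ _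
    have hec : e ∈ (A.homeo i ≫ₕ c).source :=
      ⟨he, show A.homeo i e ∈ c.source from mem_chart_source _ _⟩
    have h1 : ContMDiffAt (IM.prod IF) (IM.prod IF) ∞ (A.homeo i ≫ₕ c) e :=
      contMDiffAt_of_mem_maximalAtlas (IsManifold.subset_maximalAtlas (A.trans_mem_atlas i hc)) hec
    have h2 : ContMDiffAt (IM.prod IF) (IM.prod IF) ∞ c.symm ((A.homeo i ≫ₕ c) e) :=
      contMDiffAt_symm_of_mem_maximalAtlas (IsManifold.subset_maximalAtlas hc)
        (mem_chart_target _ _)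
    refine ((h2.comp e h1).congr_of_eventuallyEq ?_).contMDiffWithinAt
    filter_upwards [(A.homeo i ≫ₕ c).open_source.mem_nhds hec] with e' he'
    exact (c.left_inv he'.2).symm
  contMDiffOn_symm := by
    intro z hz
    let c := chartAt (ModelProd HM HF) z
    have hc : c ∈ atlas (ModelProd HM HF) (M × F) := chart_mem_atlas _ _
    have h1 : ContMDiffAt (IM.prod IF) (IM.prod IF) ∞ c z :=
      contMDiffAt_of_mem_maximalAtlas (IsManifold.subset_maximalAtlas hc) (mem_chart_source _ _)
    have hcz : c z ∈ (A.homeo i ≫ₕ c).target := by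
      refine ⟨mem_chart_target _ _, ?_⟩
      rw [Set.mem_preimage, OpenPartialHomeomorph.left_inv _ (mem_chart_source _ _)]
      exact hz
    have h2 : ContMDiffAt (IM.prod IF) (IM.prod IF) ∞ (A.homeo i ≫ₕ c).symm (c z) :=
      contMDiffAt_symm_of_mem_maximalAtlas
        (IsManifold.subset_maximalAtlas (A.trans_mem_atlas i hc)) hcz
    refine ((h2.comp z h1).congr_of_eventuallyEq ?_).contMDiffWithinAt
    filter_upwards [c.open_source.mem_nhds (mem_chart_source _ z)] with z' hz'
    exact congrArg (A.homeo i).symm (c.left_inv hz').symm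

theorem contMDiff_proj : ContMDiff (IM.prod IF) IM ∞ A.proj := fun e =>
  SmoothTriv.contMDiffAt_proj (t := A.triv (A.proj e)) (A.mem_base _)

end FiberAtlas

end Fibration

end

noncomputable section

/-! ### Local trivializations of principal bundles -/

namespace PrincipalBundle

variable {n : ℕ} {M : Type u} [TopologicalSpace M] [ChartedSpace (EuclideanSpace ℝ (Fin n)) M]
  {EG : Type} [NormedAddCommGroup EG] [NormedSpace ℝ EG]
  {HG : Type} [TopologicalSpace HG] {IG : ModelWithCorners ℝ EG HG}
  {G : Type} [TopologicalSpace G] [ChartedSpace HG G] [Group G]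

/-- A smooth equivariant local trivialization of a principal bundle. -/
structure Triv (P : PrincipalBundle n M IG G) extends SmoothTriv (𝓡 n) IG G P.proj where
  map_act : ∀ p ∈ φ.source, ∀ g, φ (P.act p g) = ((φ p).1, (φ p).2 * g)

variable (P : PrincipalBundle n M IG G)

theorem exists_triv (x : M) : ∃ t : P.Triv, x ∈ t.base := by
  obtain ⟨U, hU, hx, φ, h1, h2, h3, h4, h5⟩ := P.locallyTrivial x
  exact ⟨⟨⟨U, hU, φ, h1, h2, h3, h4, fun e he => (h5 e he).1⟩, fun e he => (h5 e he).2⟩, hx⟩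

/-- A local trivialization around `x`. -/
def trivAt (x : M) : P.Triv := (P.exists_triv x).choose

theorem mem_trivAt_base (x : M) : x ∈ (P.trivAt x).base := (P.exists_triv x).choose_spec

theorem proj_act (p : P.Total) (g : G) : P.proj (P.act p g) = P.proj p :=
  ((P.proj_eq_iff _ _).2 ⟨g, rfl⟩).symm

theorem act_act_inv (p : P.Total) (g : G) : P.act (P.act p g) g⁻¹ = p := by
  rw [← P.act_mul, mul_inv_cancel, P.act_one]

variable {P}

theorem Triv.coord_act (t : P.Triv) {p : P.Total} (hp : P.proj p ∈ t.base) (g : G) :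
    t.coord (P.act p g) = t.coord p * g :=
  congrArg Prod.snd (t.map_act p (SmoothTriv.mem_source hp) g)

theorem Triv.act_point (t : P.Triv) {x : M} (hx : x ∈ t.base) (g h : G) :
    P.act (t.point x g) h = t.point x (g * h) := by
  have h1 := SmoothTriv.proj_point hx g
  have h2 := SmoothTriv.proj_point hx (g * h)
  refine SmoothTriv.ext_of_coord (t := t.toSmoothTriv) (h2.symm ▸ hx)
    ((P.proj_act _ _).trans (h1.trans h2.symm)) ?_
  rw [t.coord_act (h1.symm ▸ hx), SmoothTriv.coord_point hx, SmoothTriv.coord_point hx]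

theorem contMDiffAt_act_comp {EN HN : Type*} [NormedAddCommGroup EN] [NormedSpace ℝ EN]
    [TopologicalSpace HN] {IN : ModelWithCorners ℝ EN HN} {N : Type*} [TopologicalSpace N]
    [ChartedSpace HN N] {a : N → P.Total} {b : N → G} {y : N}
    (ha : ContMDiffAt IN ((𝓡 n).prod IG) ∞ a y) (hb : ContMDiffAt IN IG ∞ b y) :
    ContMDiffAt IN ((𝓡 n).prod IG) ∞ (fun n => P.act (a n) (b n)) y :=
  (P.contMDiff_act.contMDiffAt (x := (a y, b y))).comp y (ha.prodMk hb)

/-! ### Morphisms of principal bundles are isomorphisms -/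

variable {Q : PrincipalBundle n M IG G}

/-- On each fibre the morphism is an equivariant map between free transitive `G`-sets. -/
theorem Hom.bijective (f : PrincipalBundle.Hom P Q) : Function.Bijective f.toFun := by
  refine ⟨fun p p' h => ?_, fun q => ?_⟩
  · obtain ⟨g, rfl⟩ := (P.proj_eq_iff p p').1 (by rw [← f.proj_comp, h, f.proj_comp])
    rw [f.equivariant] at h
    rw [Q.free _ _ h.symm, P.act_one]
  · obtain ⟨p, hp⟩ := P.surjective_proj (Q.proj q)
    obtain ⟨g, rfl⟩ := (Q.proj_eq_iff (f.toFun p) q).1 ((f.proj_comp p).trans hp)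
    exact ⟨P.act p g, f.equivariant p g⟩

/-- The inverse of a morphism of principal bundles. -/
def Hom.symm [LieGroup IG ∞ G] (f : PrincipalBundle.Hom P Q) : PrincipalBundle.Hom Q P := by
  let e := Equiv.ofBijective _ f.bijective
  have he (q) : f.toFun (e.symm q) = q := e.apply_symm_apply q
  have hproj (q) : P.proj (e.symm q) = Q.proj q := by rw [← f.proj_comp, he]
  refine ⟨e.symm, fun q₀ => ?_, hproj, fun q g => f.bijective.1 ?_⟩
  · let t := P.trivAt (Q.proj q₀)
    let t' := Q.trivAt (Q.proj q₀)
    have ht : Q.proj q₀ ∈ t.base := P.mem_trivAt_base _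
    have ht' : Q.proj q₀ ∈ t'.base := Q.mem_trivAt_base _
    have hpr : ContMDiffAt ((𝓡 n).prod IG) (𝓡 n) ∞ Q.proj q₀ := Q.contMDiff_proj q₀
    -- The local section of `P` with group coordinate `1`, pulled back to `Q`. Near `q₀` the inverse
    -- sends `q` to `s q` moved by the group element carrying `f (s q)` to `q`, a smooth quotient of
    -- coordinates.
    let s : Q.Total → P.Total := fun q => t.point (Q.proj q) 1
    have hs : ContMDiffAt ((𝓡 n).prod IG) ((𝓡 n).prod IG) ∞ s q₀ :=
      SmoothTriv.contMDiffAt_point_comp (a := Q.proj) ht hpr contMDiffAt_const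
    have hfs := (f.contMDiff (s q₀)).comp q₀ hs
    have hsq (q) (hq : Q.proj q ∈ t.base) : Q.proj (f.toFun (s q)) = Q.proj q :=
      (f.proj_comp _).trans (SmoothTriv.proj_point hq _)
    have hc : ContMDiffAt ((𝓡 n).prod IG) IG ∞ (fun q => t'.coord (f.toFun (s q))) q₀ :=
      (SmoothTriv.contMDiffAt_coord (t := t'.toSmoothTriv) ((hsq q₀ ht).symm ▸ ht')).comp q₀ hfs
    have hc' := SmoothTriv.contMDiffAt_coord (t := t'.toSmoothTriv) ht'
    refine (contMDiffAt_act_comp hs (hc.inv.mul hc')).congr_of_eventuallyEq ?_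
    filter_upwards [hpr.continuousAt.preimage_mem_nhds (t.isOpen_base.mem_nhds ht),
      hpr.continuousAt.preimage_mem_nhds (t'.isOpen_base.mem_nhds ht')] with q hq hq'
    refine f.bijective.1 ?_
    rw [he, f.equivariant]
    have h1 := hsq q hq
    refine SmoothTriv.ext_of_coord (t := t'.toSmoothTriv) ?_ ?_ ?_
    · rw [Q.proj_act, h1]; exact hq'
    · rw [Q.proj_act, h1]
    · rw [t'.coord_act (by rw [h1]; exact hq')]
      exact (mul_inv_cancel_left _ _).symm
  · rw [he, f.equivariant, he]

/-- A morphism of principal bundles, as an isomorphism. -/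
def Hom.toIso [LieGroup IG ∞ G] (f : P ⟶ Q) : P ≅ Q where
  hom := f
  inv := Hom.symm f
  hom_inv_id := PrincipalBundle.Hom.ext
    (funext fun p => (Equiv.ofBijective _ f.bijective).symm_apply_apply p)
  inv_hom_id := PrincipalBundle.Hom.ext
    (funext fun p => (Equiv.ofBijective _ f.bijective).apply_symm_apply p)

end PrincipalBundle

/-! ### Local trivializations of double vector bundles -/

namespace DoubleVectorBundle

variable {n : ℕ} {M : Type u} [TopologicalSpace M] [ChartedSpace (EuclideanSpace ℝ (Fin n)) M]
  {d d' d₀ : ℕ}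

/-- A smooth local trivialization of a double vector bundle. -/
structure Triv (E : DoubleVectorBundle n M d d' d₀) extends
    SmoothTriv (𝓡 n) 𝓘(ℝ, DVS d d' d₀) (DVS d d' d₀) E.proj where
  map_h₁ : ∀ e ∈ φ.source, ∀ t, φ (E.h₁ t e) = ((φ e).1, DVS.h₁ t (φ e).2)
  map_h₂ : ∀ e ∈ φ.source, ∀ t, φ (E.h₂ t e) = ((φ e).1, DVS.h₂ t (φ e).2)

variable (E : DoubleVectorBundle n M d d' d₀)

theorem exists_triv (x : M) : ∃ t : E.Triv, x ∈ t.base := by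
  obtain ⟨U, hU, hx, φ, h1, h2, h3, h4, h5⟩ := E.locallyTrivial x
  exact ⟨⟨⟨U, hU, φ, h1, h2, h3, h4, fun e he => (h5 e he).1⟩,
    fun e he t => ((h5 e he).2 t).1, fun e he t => ((h5 e he).2 t).2⟩, hx⟩

/-- A local trivialization around `x`. -/
def trivAt (x : M) : E.Triv := (E.exists_triv x).choose

theorem mem_trivAt_base (x : M) : x ∈ (E.trivAt x).base := (E.exists_triv x).choose_spec

variable {E} (t : E.Triv)

theorem Triv.coord_h₁ {e : E.Total} (he : E.proj e ∈ t.base) (c : ℝ) :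
    t.coord (E.h₁ c e) = DVS.h₁ c (t.coord e) :=
  congrArg Prod.snd (t.map_h₁ e (SmoothTriv.mem_source he) c)

theorem Triv.coord_h₂ {e : E.Total} (he : E.proj e ∈ t.base) (c : ℝ) :
    t.coord (E.h₂ c e) = DVS.h₂ c (t.coord e) :=
  congrArg Prod.snd (t.map_h₂ e (SmoothTriv.mem_source he) c)

theorem Triv.point_h₁ {x : M} (hx : x ∈ t.base) (c : ℝ) (v : DVS d d' d₀) :
    t.point x (DVS.h₁ c v) = E.h₁ c (t.point x v) := by
  have h (v) := SmoothTriv.proj_point (t := t.toSmoothTriv) hx v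
  refine SmoothTriv.ext_of_coord (t := t.toSmoothTriv) ?_ ?_ ?_
  · rw [E.proj_h₁, h]; exact hx
  · rw [E.proj_h₁, h, h]
  · rw [t.coord_h₁ (by rw [h]; exact hx), SmoothTriv.coord_point hx, SmoothTriv.coord_point hx]

theorem Triv.point_h₂ {x : M} (hx : x ∈ t.base) (c : ℝ) (v : DVS d d' d₀) :
    t.point x (DVS.h₂ c v) = E.h₂ c (t.point x v) := by
  have h (v) := SmoothTriv.proj_point (t := t.toSmoothTriv) hx v
  refine SmoothTriv.ext_of_coord (t := t.toSmoothTriv) ?_ ?_ ?_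
  · rw [E.proj_h₂, h]; exact hx
  · rw [E.proj_h₂, h, h]
  · rw [t.coord_h₂ (by rw [h]; exact hx), SmoothTriv.coord_point hx, SmoothTriv.coord_point hx]

/-! ### Frames -/

/-- The frames given by a local trivialization. -/
theorem Triv.isFrame {x : M} (hx : x ∈ t.base) (g : DVAut d d' d₀) :
    IsFrame E x (fun v => t.point x (g • v)) where
  contMDiff v := SmoothTriv.contMDiffAt_point_comp (a := fun _ => x) hx contMDiffAt_const
    (contMDiffAt_const.dvAut_smul contMDiffAt_id)
  bijOn := by
    refine ⟨fun v _ => SmoothTriv.proj_point hx _, fun v _ w _ h => ?_, fun e he => ?_⟩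
    · have := congrArg t.coord h
      simp only [SmoothTriv.coord_point hx] at this
      exact MulAction.injective g this
    · rw [Set.mem_preimage, Set.mem_singleton_iff] at he
      subst he
      exact ⟨g⁻¹ • t.coord e, trivial, by simp only [smul_inv_smul, SmoothTriv.point_coord hx]⟩
  map_h₁ c v := by rw [DVAut.smul_h₁, t.point_h₁ hx]
  map_h₂ c v := by rw [DVAut.smul_h₂, t.point_h₂ hx]

theorem _root_.IsFrame.proj_eq {x : M} {ψ : DVS d d' d₀ → E.Total} (h : IsFrame E x ψ)
    (v : DVS d d' d₀) : E.proj (ψ v) = x :=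
  h.bijOn.1 (Set.mem_univ v)

theorem _root_.IsFrame.comp_smul {x : M} {ψ : DVS d d' d₀ → E.Total} (h : IsFrame E x ψ)
    (g : DVAut d d' d₀) : IsFrame E x (fun v => ψ (g • v)) where
  contMDiff := h.contMDiff.comp fun v => contMDiffAt_const.dvAut_smul contMDiffAt_id
  bijOn := h.bijOn.comp (Set.bijOn_univ.2 (MulAction.bijective g))
  map_h₁ c v := by rw [DVAut.smul_h₁, h.map_h₁]
  map_h₂ c v := by rw [DVAut.smul_h₂, h.map_h₂]

/-- In a local trivialization, a frame is given by an element of the structure group. -/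
theorem Triv.exists_smul_eq {x : M} (hx : x ∈ t.base) {ψ : DVS d d' d₀ → E.Total}
    (h : IsFrame E x ψ) : ∃ g : DVAut d d' d₀, ∀ v, t.coord (ψ v) = g • v := by
  have hb (v) : E.proj (ψ v) ∈ t.base := (h.proj_eq v).symm ▸ hx
  -- The four goals are differentiability, injectivity and the two homotheties for the frame in
  -- fibre coordinates.
  refine DVAut.exists_smul_eq_of_commute ?_ ?_ ?_ ?_
  · have : ContMDiff 𝓘(ℝ, DVS d d' d₀) 𝓘(ℝ, DVS d d' d₀) ∞ (fun v => t.coord (ψ v)) := fun v =>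
      (SmoothTriv.contMDiffAt_coord (t := t.toSmoothTriv) (hb v)).comp v (h.contMDiff v)
    exact this.contDiff.differentiable (by simp)
  · intro v w hvw
    exact h.bijOn.injOn trivial trivial (SmoothTriv.ext_of_coord (t := t.toSmoothTriv) (hb w)
      ((h.proj_eq v).trans (h.proj_eq w).symm) hvw)
  · intro c v
    simp only [h.map_h₁, t.coord_h₁ (hb v)]
  · intro c v
    simp only [h.map_h₂, t.coord_h₂ (hb v)]

/-- An isomorphism of double vector bundles maps frames to frames. -/
theorem _root_.IsFrame.comp_iso {F : DoubleVectorBundle n M d d' d₀} (f : E ≅ F) {x : M}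
    {ψ : DVS d d' d₀ → E.Total} (h : IsFrame E x ψ) : IsFrame F x (fun v => f.hom.toFun (ψ v)) where
  contMDiff := f.hom.contMDiff.comp h.contMDiff
  bijOn := by
    have h1 (e) : f.inv.toFun (f.hom.toFun e) = e :=
      congrFun (congrArg DoubleVectorBundle.Hom.toFun f.hom_inv_id) e
    have h2 (e) : f.hom.toFun (f.inv.toFun e) = e :=
      congrFun (congrArg DoubleVectorBundle.Hom.toFun f.inv_hom_id) e
    refine Set.BijOn.comp (t := E.proj ⁻¹' {x}) ⟨fun e he => ?_, fun e _ e' _ hee => ?_,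
      fun e he => ⟨f.inv.toFun e, ?_, h2 e⟩⟩ h.bijOn
    · exact (f.hom.proj_comp e).trans he
    · rw [← h1 e, hee, h1]
    · exact (f.inv.proj_comp e).trans he
  map_h₁ c v := by rw [h.map_h₁, f.hom.map_h₁]
  map_h₂ c v := by rw [h.map_h₂, f.hom.map_h₂]

end DoubleVectorBundle

end

noncomputable section

variable {n : ℕ} {M : Type u} [TopologicalSpace M] [ChartedSpace (EuclideanSpace ℝ (Fin n)) M]
  {d d' d₀ : ℕ}

/-! ### The associated bundle -/

namespace PrincipalBundle

variable (P : DVPrincipal n M d d' d₀)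

/-- The orbit relation of the right action `(p, v) g = (p g, g⁻¹ v)`. -/
def assocSetoid : Setoid (P.Total × DVS d d' d₀) where
  r a b := ∃ g : DVAut d d' d₀, b.1 = P.act a.1 g ∧ b.2 = g⁻¹ • a.2
  iseqv :=
    { refl := fun a => ⟨1, (P.act_one _).symm, by simp⟩
      symm := by
        rintro ⟨p, v⟩ ⟨p', v'⟩ ⟨g, h1, h2⟩
        dsimp only at h1 h2
        subst h1 h2
        exact ⟨g⁻¹, (P.act_act_inv p g).symm, by simp⟩
      trans := by
        rintro ⟨p, v⟩ ⟨p', v'⟩ ⟨p'', v''⟩ ⟨g, h1, h2⟩ ⟨h, h3, h4⟩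
        dsimp only at h1 h2 h3 h4
        subst h1 h2 h3 h4
        exact ⟨g * h, (P.act_mul _ _ _).symm, by simp [mul_smul]⟩ }

/-- The set `(P × ℝ^{(d,d',d₀)}) / 𝔾`. -/
def AssocTotal : Type u := Quotient P.assocSetoid

variable {P}

/-- The class `[p, v]`. -/
def assocMk (p : P.Total) (v : DVS d d' d₀) : P.AssocTotal := Quotient.mk P.assocSetoid (p, v)

theorem assocMk_eq_iff {p p' : P.Total} {v v' : DVS d d' d₀} :
    assocMk p v = assocMk p' v' ↔ ∃ g : DVAut d d' d₀, p' = P.act p g ∧ v' = g⁻¹ • v :=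
  Quotient.eq (r := P.assocSetoid)

theorem assocMk_act (p : P.Total) (g : DVAut d d' d₀) (v : DVS d d' d₀) :
    assocMk (P.act p g) v = assocMk p (g • v) :=
  (assocMk_eq_iff.2 ⟨g, rfl, by simp⟩).symm

/-- A map on `P × ℝ^{(d,d',d₀)}` which is balanced for the action induces a map on the quotient. -/
def assocLift {X : Type*} (f : P.Total → DVS d d' d₀ → X)
    (hf : ∀ p g v, f (P.act p g) v = f p (g • v)) : P.AssocTotal → X :=
  Quotient.lift (fun a => f a.1 a.2) <| by
    rintro ⟨p, v⟩ ⟨p', v'⟩ ⟨g, h1, h2⟩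
    dsimp only at h1 h2 ⊢
    subst h1 h2
    rw [hf, smul_inv_smul]

@[simp] theorem assocLift_mk {X : Type*} (f : P.Total → DVS d d' d₀ → X)
    (hf : ∀ p g v, f (P.act p g) v = f p (g • v)) (p : P.Total) (v : DVS d d' d₀) :
    assocLift f hf (assocMk p v) = f p v := rfl

theorem exists_assocMk_eq (e : P.AssocTotal) : ∃ p v, assocMk p v = e :=
  Quotient.inductionOn e fun a => ⟨a.1, a.2, rfl⟩

open Classical in
/-- The fibre coordinate of the associated bundle in a local trivialization of `P`. -/
def Triv.assocCoord (t : P.Triv) : P.AssocTotal → DVS d d' d₀ :=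
  -- The value `0` off the base is arbitrary. On it, `t.coord p • v` is balanced because the
  -- coordinate of `p g` is that of `p` times `g`.
  assocLift (fun p v => if P.proj p ∈ t.base then t.coord p • v else 0) <| by
    intro p g v
    by_cases hp : P.proj p ∈ t.base
    · simp [P.proj_act, hp, t.coord_act hp, mul_smul]
    · simp [P.proj_act, hp]

theorem Triv.assocCoord_mk (t : P.Triv) {p : P.Total} (hp : P.proj p ∈ t.base)
    (v : DVS d d' d₀) : t.assocCoord (assocMk p v) = t.coord p • v := by
  simp [assocCoord, hp]

variable (P)

/-- The local trivializations of the associated bundle. -/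
def assocAtlas : FiberAtlas (𝓡 n) 𝓘(ℝ, DVS d d' d₀) (DVS d d' d₀) M where
  Total := P.AssocTotal
  proj := assocLift (fun p _ => P.proj p) fun p g _ => P.proj_act p g
  base i := (P.trivAt i).base
  isOpen_base i := (P.trivAt i).isOpen_base
  mem_base := P.mem_trivAt_base
  coord i := (P.trivAt i).assocCoord
  -- A point is represented over the local section with group coordinate `1`; the coordinate changes
  -- are then the action of the transition functions of `P`.
  point i x v := assocMk ((P.trivAt i).point x 1) v
  proj_point i x v hx := SmoothTriv.proj_point hx 1
  coord_point i x v hx := by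
    rw [Triv.assocCoord_mk, SmoothTriv.coord_point hx, one_smul]
    rw [SmoothTriv.proj_point hx]; exact hx
  point_coord i e := by
    obtain ⟨p, v, rfl⟩ := exists_assocMk_eq e
    intro (hp : P.proj p ∈ (P.trivAt i).base)
    change assocMk ((P.trivAt i).point (P.proj p) 1) _ = _
    rw [Triv.assocCoord_mk _ hp, ← assocMk_act, Triv.act_point _ hp, one_mul,
      SmoothTriv.point_coord hp]
  contMDiffAt_coord_point i j x v hi hj := by
    have hp : ContMDiffAt ((𝓡 n).prod 𝓘(ℝ, DVS d d' d₀)) ((𝓡 n).prod (DVAutI d d' d₀)) ∞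
        (fun z : M × DVS d d' d₀ => (P.trivAt i).point z.1 1) (x, v) :=
      SmoothTriv.contMDiffAt_point_comp (a := Prod.fst) hi contMDiffAt_fst contMDiffAt_const
    have hpx : P.proj ((P.trivAt i).point x 1) ∈ (P.trivAt j).base := by
      rw [SmoothTriv.proj_point hi]; exact hj
    have hc := (SmoothTriv.contMDiffAt_coord hpx).comp (x, v) hp
    refine (hc.dvAut_smul contMDiffAt_snd).congr_of_eventuallyEq ?_
    filter_upwards [continuousAt_fst.preimage_mem_nhds ((P.trivAt i).isOpen_base.mem_nhds hi),
      continuousAt_fst.preimage_mem_nhds ((P.trivAt j).isOpen_base.mem_nhds hj)] with z hz hz'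
    refine Triv.assocCoord_mk _ ?_ _
    rw [SmoothTriv.proj_point hz]; exact hz'

/-- The class `[p, v]`, as a point of the associated bundle. -/
def assocQ (z : P.Total × DVS d d' d₀) : P.assocAtlas.Total := assocMk z.1 z.2

/-- The map `[p, v] ↦ [p, k v]`, for `k` commuting with the structure group. -/
def assocMap {P : DVPrincipal n M d d' d₀} (k : DVS d d' d₀ → DVS d d' d₀) (hk : ∀ (g : DVAut d d' d₀) v, g • k v = k (g • v)) :
    P.assocAtlas.Total → P.assocAtlas.Total :=
  assocLift (fun p v => assocMk p (k v)) fun p g v => by rw [assocMk_act, hk]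

theorem assocAtlas_proj_map {P : DVPrincipal n M d d' d₀} {k : DVS d d' d₀ → DVS d d' d₀}
    (hk : ∀ (g : DVAut d d' d₀) v, g • k v = k (g • v)) (e : P.assocAtlas.Total) :
    P.assocAtlas.proj (assocMap k hk e) = P.assocAtlas.proj e := by
  obtain ⟨p, v, rfl⟩ := exists_assocMk_eq e
  rfl

/-! ### Smoothness of the quotient map and of the homotheties -/

section

variable [IsManifold (𝓡 n) ∞ M]

theorem assocAtlas_coord_mk (i : M) {p : P.Total} (hp : P.proj p ∈ (P.trivAt i).base)
    (v : DVS d d' d₀) :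
    (P.assocAtlas.triv i).coord (assocMk p v) = (P.trivAt i).coord p • v :=
  Triv.assocCoord_mk _ hp v

theorem contMDiff_assocQ : ContMDiff (((𝓡 n).prod (DVAutI d d' d₀)).prod 𝓘(ℝ, DVS d d' d₀))
    ((𝓡 n).prod 𝓘(ℝ, DVS d d' d₀)) ∞ P.assocQ := by
  intro z
  have hz : P.proj z.1 ∈ (P.trivAt (P.proj z.1)).base := P.mem_trivAt_base _
  have hp : ContMDiffAt (((𝓡 n).prod (DVAutI d d' d₀)).prod 𝓘(ℝ, DVS d d' d₀)) (𝓡 n) ∞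
      (fun z : P.Total × DVS d d' d₀ => P.proj z.1) z :=
    (P.contMDiff_proj z.1).comp z contMDiffAt_fst
  refine SmoothTriv.contMDiffAt_of_coord (t := P.assocAtlas.triv (P.proj z.1)) hz hp ?_
  refine (((SmoothTriv.contMDiffAt_coord hz).comp z contMDiffAt_fst).dvAut_smul
    contMDiffAt_snd).congr_of_eventuallyEq ?_
  filter_upwards [hp.continuousAt.preimage_mem_nhds
    ((P.trivAt (P.proj z.1)).isOpen_base.mem_nhds hz)] with w hw
  exact P.assocAtlas_coord_mk _ hw _

/-- The quotient map has a smooth local section through every point `z = (p, v)`: keep the group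
coordinate `g` of `p` fixed along the base, and correct the fibre coordinate by `g⁻¹`. -/
theorem exists_section (z : P.Total × DVS d d' d₀) :
    ∃ s : P.assocAtlas.Total → P.Total × DVS d d' d₀,
      ContMDiffAt ((𝓡 n).prod 𝓘(ℝ, DVS d d' d₀))
        (((𝓡 n).prod (DVAutI d d' d₀)).prod 𝓘(ℝ, DVS d d' d₀)) ∞ s (P.assocQ z) ∧
      s (P.assocQ z) = z ∧ ∀ᶠ e in nhds (P.assocQ z), P.assocQ (s e) = e := by
  obtain ⟨p, v⟩ := z
  let A := P.assocAtlas
  let t := P.trivAt (P.proj p)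
  have ht : P.proj p ∈ t.base := P.mem_trivAt_base _
  have hpr : ContMDiffAt ((𝓡 n).prod 𝓘(ℝ, DVS d d' d₀)) (𝓡 n) ∞ A.proj (P.assocQ (p, v)) :=
    A.contMDiff_proj _
  let g := t.coord p
  refine ⟨fun e => (t.point (A.proj e) g, g⁻¹ • (A.triv (P.proj p)).coord e), ?_, ?_, ?_⟩
  · refine ContMDiffAt.prodMk ?_ ?_
    · exact SmoothTriv.contMDiffAt_point_comp (a := A.proj) ht hpr contMDiffAt_const
    · exact contMDiffAt_const.dvAut_smul
        (SmoothTriv.contMDiffAt_coord (t := A.triv (P.proj p)) ht)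
  · refine Prod.ext (SmoothTriv.point_coord ht) ?_
    exact (congrArg (g⁻¹ • ·) (P.assocAtlas_coord_mk _ ht v)).trans (inv_smul_smul _ _)
  · filter_upwards [hpr.continuousAt.preimage_mem_nhds (t.isOpen_base.mem_nhds ht)] with e he
    have h1 : P.proj (t.point (A.proj e) g) = A.proj e := SmoothTriv.proj_point he g
    refine SmoothTriv.ext_of_coord (t := A.triv (P.proj p)) he h1 ?_
    refine (P.assocAtlas_coord_mk _ (h1.symm ▸ he) _).trans ?_
    rw [SmoothTriv.coord_point he, smul_inv_smul]

/-- A map on the associated bundle is smooth if its composition with `(p, v) ↦ [p, v]` is. -/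
theorem contMDiff_of_comp_assocQ {EN HN : Type*} [NormedAddCommGroup EN] [NormedSpace ℝ EN]
    [TopologicalSpace HN] {IN : ModelWithCorners ℝ EN HN} {N : Type*} [TopologicalSpace N]
    [ChartedSpace HN N] {f : P.assocAtlas.Total → N}
    (hf : ContMDiff (((𝓡 n).prod (DVAutI d d' d₀)).prod 𝓘(ℝ, DVS d d' d₀)) IN ∞
      (fun z => f (P.assocQ z))) :
    ContMDiff ((𝓡 n).prod 𝓘(ℝ, DVS d d' d₀)) IN ∞ f := by
  intro e
  obtain ⟨p, v, rfl⟩ := exists_assocMk_eq e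
  obtain ⟨s, hs, -, h⟩ := P.exists_section (p, v)
  refine ((hf _).comp _ hs).congr_of_eventuallyEq ?_
  filter_upwards [h] with e he
  exact congrArg f he.symm

/-- Differentiating `P.assocQ ∘ s = id` for a local section `s` gives a right inverse of the
derivative. -/
theorem mfderiv_assocQ_surjective (z : P.Total × DVS d d' d₀) : Function.Surjective
    (mfderiv (((𝓡 n).prod (DVAutI d d' d₀)).prod 𝓘(ℝ, DVS d d' d₀))
      ((𝓡 n).prod 𝓘(ℝ, DVS d d' d₀)) P.assocQ z) := by
  obtain ⟨s, hs, hsz, h⟩ := P.exists_section z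
  have hs' := (hs.mdifferentiableAt (by simp)).hasMFDerivAt
  have hq : HasMFDerivAt (((𝓡 n).prod (DVAutI d d' d₀)).prod 𝓘(ℝ, DVS d d' d₀))
      ((𝓡 n).prod 𝓘(ℝ, DVS d d' d₀)) P.assocQ (s (P.assocQ z))
      (mfderiv (((𝓡 n).prod (DVAutI d d' d₀)).prod 𝓘(ℝ, DVS d d' d₀))
      ((𝓡 n).prod 𝓘(ℝ, DVS d d' d₀)) P.assocQ (s (P.assocQ z))) :=
    ((P.contMDiff_assocQ _).mdifferentiableAt (by simp)).hasMFDerivAt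
  have h1 := hq.comp _ hs'
  have h2 := (hasMFDerivAt_id (I := (𝓡 n).prod 𝓘(ℝ, DVS d d' d₀)) (P.assocQ z)).congr_of_eventuallyEq
    (f₁ := P.assocQ ∘ s) h
  have h3 := hasMFDerivAt_unique h1 h2
  rw [hsz] at h3
  intro w
  exact ⟨_, congrArg (fun L => L w) h3⟩

theorem assocAtlas_coord_map {k : DVS d d' d₀ → DVS d d' d₀}
    (hk : ∀ (g : DVAut d d' d₀) v, g • k v = k (g • v)) {i : M} {e : P.assocAtlas.Total}
    (he : P.assocAtlas.proj e ∈ (P.trivAt i).base) :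
    (P.assocAtlas.triv i).coord (assocMap k hk e) = k ((P.assocAtlas.triv i).coord e) := by
  obtain ⟨p, v, rfl⟩ := exists_assocMk_eq e
  have hp : P.proj p ∈ (P.trivAt i).base := he
  have h (w) := P.assocAtlas_coord_mk i hp w
  exact (h _).trans ((hk _ _).trans (congrArg k (h v).symm))

theorem contMDiff_assocMap {k : ℝ → DVS d d' d₀ → DVS d d' d₀}
    (hk : ∀ c (g : DVAut d d' d₀) v, g • k c v = k c (g • v))
    (hk' : ContDiff ℝ ∞ fun z : ℝ × DVS d d' d₀ => k z.1 z.2) :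
    ContMDiff (𝓘(ℝ, ℝ).prod ((𝓡 n).prod 𝓘(ℝ, DVS d d' d₀))) ((𝓡 n).prod 𝓘(ℝ, DVS d d' d₀)) ∞
      (fun z : ℝ × P.assocAtlas.Total => assocMap (k z.1) (hk z.1) z.2) := by
  rintro ⟨c, e⟩
  have he : P.assocAtlas.proj e ∈ (P.trivAt (P.assocAtlas.proj e)).base := P.mem_trivAt_base _
  have hp : ContMDiffAt (𝓘(ℝ, ℝ).prod ((𝓡 n).prod 𝓘(ℝ, DVS d d' d₀))) (𝓡 n) ∞
      (fun z : ℝ × P.assocAtlas.Total => P.assocAtlas.proj z.2) (c, e) :=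
    (P.assocAtlas.contMDiff_proj e).comp (c, e) contMDiffAt_snd
  refine SmoothTriv.contMDiffAt_of_coord (t := P.assocAtlas.triv (P.assocAtlas.proj e)) ?_ ?_ ?_
  · rw [assocAtlas_proj_map]; exact he
  · simpa only [assocAtlas_proj_map] using hp
  · have hc : ContMDiffAt (𝓘(ℝ, ℝ).prod ((𝓡 n).prod 𝓘(ℝ, DVS d d' d₀))) 𝓘(ℝ, DVS d d' d₀) ∞
        (fun z : ℝ × P.assocAtlas.Total =>
          (P.assocAtlas.triv (P.assocAtlas.proj e)).coord z.2) (c, e) :=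
      ContMDiffAt.comp (g := (P.assocAtlas.triv (P.assocAtlas.proj e)).coord) (c, e)
        (SmoothTriv.contMDiffAt_coord he) contMDiffAt_snd
    have h1 : ContMDiffAt (𝓘(ℝ, ℝ).prod ((𝓡 n).prod 𝓘(ℝ, DVS d d' d₀))) 𝓘(ℝ, ℝ) ∞
        (fun z : ℝ × P.assocAtlas.Total => z.1) (c, e) := contMDiffAt_fst
    refine (hk'.comp_contMDiffAt (h1.prodMk_space hc)).congr_of_eventuallyEq ?_
    filter_upwards [hp.continuousAt.preimage_mem_nhds
      ((P.trivAt (P.assocAtlas.proj e)).isOpen_base.mem_nhds he)] with z hz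
    exact P.assocAtlas_coord_map (hk z.1) hz

variable [T2Space M] [SecondCountableTopology M]

/-- The associated bundle `P ×_𝔾 ℝ^{(d,d',d₀)}`. -/
def assoc : DoubleVectorBundle n M d d' d₀ where
  Total := P.assocAtlas.Total
  proj := P.assocAtlas.proj
  contMDiff_proj := P.assocAtlas.contMDiff_proj
  h₁ c := assocMap (DVS.h₁ c) fun g v => DVAut.smul_h₁ g c v
  h₂ c := assocMap (DVS.h₂ c) fun g v => DVAut.smul_h₂ g c v
  h₁_one e := by
    obtain ⟨p, v, rfl⟩ := exists_assocMk_eq e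
    exact congrArg (assocMk p) (by simp [DVS.h₁])
  h₂_one e := by
    obtain ⟨p, v, rfl⟩ := exists_assocMk_eq e
    exact congrArg (assocMk p) (by simp [DVS.h₂])
  h₁_mul s t e := by
    obtain ⟨p, v, rfl⟩ := exists_assocMk_eq e
    exact congrArg (assocMk p) (by simp [DVS.h₁, mul_smul])
  h₂_mul s t e := by
    obtain ⟨p, v, rfl⟩ := exists_assocMk_eq e
    exact congrArg (assocMk p) (by simp [DVS.h₂, mul_smul])
  h_comm s t e := by
    obtain ⟨p, v, rfl⟩ := exists_assocMk_eq e
    exact congrArg (assocMk p) (by simp [DVS.h₁, DVS.h₂, smul_comm s t])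
  contMDiff_h₁ := P.contMDiff_assocMap (k := DVS.h₁) (fun c g v => DVAut.smul_h₁ g c v)
    (by unfold DVS.h₁; fun_prop)
  contMDiff_h₂ := P.contMDiff_assocMap (k := DVS.h₂) (fun c g v => DVAut.smul_h₂ g c v)
    (by unfold DVS.h₂; fun_prop)
  proj_h₁ t e := by
    obtain ⟨p, v, rfl⟩ := exists_assocMk_eq e
    rfl
  proj_h₂ t e := by
    obtain ⟨p, v, rfl⟩ := exists_assocMk_eq e
    rfl
  locallyTrivial x := by
    let t := P.assocAtlas.triv x
    refine ⟨t.base, t.isOpen_base, P.mem_trivAt_base x, t.φ, t.source_eq, t.target_eq,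
      t.contMDiffOn_φ, t.contMDiffOn_symm, fun e he => ⟨t.fst_φ e he, fun c => ?_⟩⟩
    exact ⟨Prod.ext (assocAtlas_proj_map _ e) (P.assocAtlas_coord_map _ he),
      Prod.ext (assocAtlas_proj_map _ e) (P.assocAtlas_coord_map _ he)⟩

theorem isAssociatedBundle : IsAssociatedBundle P P.assoc P.assocQ where
  contMDiff := P.contMDiff_assocQ
  surjective e := by
    obtain ⟨p, v, rfl⟩ := exists_assocMk_eq e
    exact ⟨(p, v), rfl⟩
  submersion := P.mfderiv_assocQ_surjective
  eq_iff _ _ _ _ := assocMk_eq_iff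
  proj_mk _ _ := rfl
  h₁_mk _ _ _ := rfl
  h₂_mk _ _ _ := rfl

/-- The map of associated bundles `[p, v] ↦ [f p, v]`. -/
def assocHom {P Q : DVPrincipal n M d d' d₀} (f : P ⟶ Q) : P.assoc ⟶ Q.assoc where
  toFun := assocLift (fun p v => assocMk (f.toFun p) v) fun p g v => by
    rw [f.equivariant, assocMk_act]
  contMDiff := P.contMDiff_of_comp_assocQ (Q.contMDiff_assocQ.comp
    ((f.contMDiff.comp contMDiff_fst).prodMk contMDiff_snd))
  proj_comp e := by
    obtain ⟨p, v, rfl⟩ := exists_assocMk_eq e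
    exact f.proj_comp p
  map_h₁ c e := by
    obtain ⟨p, v, rfl⟩ := exists_assocMk_eq e
    rfl
  map_h₂ c e := by
    obtain ⟨p, v, rfl⟩ := exists_assocMk_eq e
    rfl

variable (n M d d' d₀) in
/-- The associated bundle functor, with values in all morphisms. -/
def assocFunctor : DVPrincipal n M d d' d₀ ⥤ DoubleVectorBundle n M d d' d₀ where
  obj P := P.assoc
  map f := assocHom f
  map_id P := DoubleVectorBundle.Hom.ext <| funext fun e => by
    obtain ⟨p, v, rfl⟩ := exists_assocMk_eq e
    rfl
  map_comp f g := DoubleVectorBundle.Hom.ext <| funext fun e => by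
    obtain ⟨p, v, rfl⟩ := exists_assocMk_eq e
    rfl

variable (n M d d' d₀) in
/-- The associated bundle functor. -/
def assocCore : DVPrincipal n M d d' d₀ ⥤ Core (DoubleVectorBundle n M d d' d₀) where
  obj P := ⟨P.assoc⟩
  -- Every morphism of principal bundles is invertible, so its image lies in the core.
  map f := ⟨(assocFunctor n M d d' d₀).mapIso (Hom.toIso f)⟩
  map_id P := Core.hom_ext ((assocFunctor n M d d' d₀).map_id P)
  map_comp f g := Core.hom_ext ((assocFunctor n M d d' d₀).map_comp f g)

end

end PrincipalBundle
end

noncomputable section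

variable {n : ℕ} {M : Type u} [TopologicalSpace M] [ChartedSpace (EuclideanSpace ℝ (Fin n)) M]
  {d d' d₀ : ℕ}

/-! ### The frame bundle -/

namespace DoubleVectorBundle

variable (E : DoubleVectorBundle n M d d' d₀)

/-- The set of frames of `E`. -/
def FrameTotal : Type u := {z : M × (DVS d d' d₀ → E.Total) // IsFrame E z.1 z.2}

variable {E}

open Classical in
/-- The coordinate of a frame in a local trivialization. -/
def Triv.frameCoord (t : E.Triv) (z : E.FrameTotal) : DVAut d d' d₀ :=
  -- The chosen element is unique because the action is faithful; the value `1` off the base is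
  -- arbitrary.
  if h : z.1.1 ∈ t.base then (t.exists_smul_eq h z.2).choose else 1

theorem Triv.frameCoord_smul (t : E.Triv) {z : E.FrameTotal} (h : z.1.1 ∈ t.base)
    (v : DVS d d' d₀) : t.frameCoord z • v = t.coord (z.1.2 v) := by
  rw [frameCoord, dif_pos h]
  exact ((t.exists_smul_eq h z.2).choose_spec v).symm

theorem Triv.point_frameCoord_smul (t : E.Triv) {z : E.FrameTotal} (h : z.1.1 ∈ t.base)
    (v : DVS d d' d₀) : t.point z.1.1 (t.frameCoord z • v) = z.1.2 v := by
  have h1 := z.2.proj_eq v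
  rw [t.frameCoord_smul h]
  conv_lhs => rw [← h1]
  exact SmoothTriv.point_coord (t := t.toSmoothTriv) (h1.symm ▸ h)

theorem FrameTotal.ext {z w : E.FrameTotal} (h : z.1.1 = w.1.1) (h' : ∀ v, z.1.2 v = w.1.2 v) :
    z = w :=
  Subtype.ext (Prod.ext h (funext h'))

/-- The frame at `x` with coordinate `g` in a local trivialization. -/
def Triv.frameOf (t : E.Triv) {x : M} (hx : x ∈ t.base) (g : DVAut d d' d₀) : E.FrameTotal :=
  ⟨(x, fun v => t.point x (g • v)), t.isFrame hx g⟩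

variable (E) in
open Classical in
/-- The frame at `x` with coordinate `g` in the local trivialization at `i`, if `x` is in its
domain. -/
def framePoint (i x : M) (g : DVAut d d' d₀) : E.FrameTotal :=
  if h : x ∈ (E.trivAt i).base then (E.trivAt i).frameOf h g
  -- This fallback is still a frame at `x`, so `framePoint_fst` holds without conditions.
  else (E.trivAt x).frameOf (E.mem_trivAt_base x) g

theorem framePoint_of_mem {i x : M} (h : x ∈ (E.trivAt i).base) (g : DVAut d d' d₀) :
    E.framePoint i x g = (E.trivAt i).frameOf h g :=
  dif_pos h

theorem framePoint_fst (i x : M) (g : DVAut d d' d₀) : (E.framePoint i x g).1.1 = x := by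
  by_cases h : x ∈ (E.trivAt i).base
  · rw [framePoint_of_mem h]; rfl
  · rw [framePoint, dif_neg h]; rfl

theorem framePoint_apply {i x : M} (h : x ∈ (E.trivAt i).base) (g : DVAut d d' d₀)
    (v : DVS d d' d₀) : (E.framePoint i x g).1.2 v = (E.trivAt i).point x (g • v) := by
  rw [framePoint_of_mem h]; rfl

variable (E)

/-- The local trivializations of the frame bundle. -/
def frameAtlas : FiberAtlas (𝓡 n) (DVAutI d d' d₀) (DVAut d d' d₀) M where
  Total := E.FrameTotal
  proj z := z.1.1
  base i := (E.trivAt i).base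
  isOpen_base i := (E.trivAt i).isOpen_base
  mem_base := E.mem_trivAt_base
  coord i := (E.trivAt i).frameCoord
  point := E.framePoint
  proj_point i x g _ := framePoint_fst i x g
  coord_point i x g hx := DVAut.eq_of_smul_eq fun v => by
    rw [Triv.frameCoord_smul _ (by rwa [framePoint_fst]), framePoint_apply hx,
      SmoothTriv.coord_point hx]
  point_coord i z hz := FrameTotal.ext (framePoint_fst _ _ _) fun v => by
    rw [framePoint_apply hz, Triv.point_frameCoord_smul _ hz]
  contMDiffAt_coord_point i j x g hi hj := DVAut.contMDiffAt_of_smul fun v => by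
    -- The transition element applied to `v` is the coordinate at `j` of the point with coordinate
    -- `g • v` at `i`.
    have hp : ContMDiffAt ((𝓡 n).prod (DVAutI d d' d₀)) ((𝓡 n).prod 𝓘(ℝ, DVS d d' d₀)) ∞
        (fun z : M × DVAut d d' d₀ => (E.trivAt i).point z.1 (z.2 • v)) (x, g) :=
      SmoothTriv.contMDiffAt_point_comp (a := Prod.fst) hi contMDiffAt_fst
        (contMDiffAt_snd.dvAut_smul contMDiffAt_const)
    have hpx : E.proj ((E.trivAt i).point x (g • v)) ∈ (E.trivAt j).base := by
      rw [SmoothTriv.proj_point hi]; exact hj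
    refine ((SmoothTriv.contMDiffAt_coord hpx).comp (x, g) hp).congr_of_eventuallyEq ?_
    filter_upwards [continuousAt_fst.preimage_mem_nhds ((E.trivAt i).isOpen_base.mem_nhds hi),
      continuousAt_fst.preimage_mem_nhds ((E.trivAt j).isOpen_base.mem_nhds hj)] with z hz hz'
    rw [Triv.frameCoord_smul _ (by rw [framePoint_fst]; exact hz'), framePoint_apply hz]
    rfl

/-! ### Smoothness of frames and the principal bundle structure -/

variable [IsManifold (𝓡 n) ∞ M]

variable {E} in
/-- A family of frames is smooth if its value on each vector is. -/
theorem contMDiff_frame_of_apply {EN HN : Type*} [NormedAddCommGroup EN] [NormedSpace ℝ EN]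
    [TopologicalSpace HN] {IN : ModelWithCorners ℝ EN HN} {N : Type*} [TopologicalSpace N]
    [ChartedSpace HN N] {h : N → E.frameAtlas.Total}
    (H : ∀ v, ContMDiff IN ((𝓡 n).prod 𝓘(ℝ, DVS d d' d₀)) ∞ fun x => (h x).1.2 v) :
    ContMDiff IN ((𝓡 n).prod (DVAutI d d' d₀)) ∞ h := by
  intro x
  have hx : E.frameAtlas.proj (h x) ∈ (E.trivAt (E.frameAtlas.proj (h x))).base :=
    E.mem_trivAt_base _
  have hp : ContMDiff IN (𝓡 n) ∞ (fun x => E.frameAtlas.proj (h x)) := by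
    -- The base point of a frame is recovered as the projection of its value at `0`.
    refine (E.contMDiff_proj.comp (H 0)).congr fun y => ?_
    exact ((h y).2.proj_eq 0).symm
  refine SmoothTriv.contMDiffAt_of_coord (t := E.frameAtlas.triv (E.frameAtlas.proj (h x)))
    hx (hp x) (DVAut.contMDiffAt_of_smul fun v => ?_)
  have hx' : E.proj ((h x).1.2 v) ∈ (E.trivAt (E.frameAtlas.proj (h x))).base := by
    rw [(h x).2.proj_eq v]; exact hx
  refine ((SmoothTriv.contMDiffAt_coord hx').comp x (H v x)).congr_of_eventuallyEq ?_
  filter_upwards [(hp x).continuousAt.preimage_mem_nhds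
    ((E.trivAt (E.frameAtlas.proj (h x))).isOpen_base.mem_nhds hx)] with y hy
  exact Triv.frameCoord_smul _ hy v

/-- In local trivializations evaluation is `(x, g, v) ↦ (x, g • v)`. -/
theorem contMDiff_frame_apply :
    ContMDiff (((𝓡 n).prod (DVAutI d d' d₀)).prod 𝓘(ℝ, DVS d d' d₀))
      ((𝓡 n).prod 𝓘(ℝ, DVS d d' d₀)) ∞
      (fun z : E.frameAtlas.Total × DVS d d' d₀ => z.1.1.2 z.2) := by
  intro z
  let t := E.trivAt (E.frameAtlas.proj z.1)
  have hz : E.frameAtlas.proj z.1 ∈ t.base := E.mem_trivAt_base _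
  have hp : ContMDiffAt (((𝓡 n).prod (DVAutI d d' d₀)).prod 𝓘(ℝ, DVS d d' d₀)) (𝓡 n) ∞
      (fun z : E.frameAtlas.Total × DVS d d' d₀ => E.frameAtlas.proj z.1) z :=
    (E.frameAtlas.contMDiff_proj z.1).comp z contMDiffAt_fst
  have hc := ((SmoothTriv.contMDiffAt_coord
    (t := E.frameAtlas.triv (E.frameAtlas.proj z.1)) hz).comp z contMDiffAt_fst).dvAut_smul
    (contMDiffAt_snd (J := 𝓘(ℝ, DVS d d' d₀)))
  refine (SmoothTriv.contMDiffAt_point_comp (t := t.toSmoothTriv)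
    (a := fun z : E.frameAtlas.Total × DVS d d' d₀ => E.frameAtlas.proj z.1) hz hp
    hc).congr_of_eventuallyEq ?_
  filter_upwards [hp.continuousAt.preimage_mem_nhds (t.isOpen_base.mem_nhds hz)] with w hw
  exact (Triv.point_frameCoord_smul t hw w.2).symm

/-- The action of the structure group on frames. -/
def frameAct (z : E.frameAtlas.Total) (g : DVAut d d' d₀) : E.frameAtlas.Total :=
  ⟨(z.1.1, fun v => z.1.2 (g • v)), z.2.comp_smul g⟩

variable [T2Space M] [SecondCountableTopology M]

/-- The frame bundle of a double vector bundle. -/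
def frame : DVPrincipal n M d d' d₀ where
  Total := E.frameAtlas.Total
  proj := E.frameAtlas.proj
  act := E.frameAct
  act_one z := FrameTotal.ext rfl fun v => congrArg z.1.2 (one_smul _ v)
  act_mul z g h := FrameTotal.ext rfl fun v => congrArg z.1.2 (mul_smul g h v)
  contMDiff_act := contMDiff_frame_of_apply fun v =>
    E.contMDiff_frame_apply.comp (contMDiff_fst.prodMk
      (fun _ => contMDiffAt_snd.dvAut_smul contMDiffAt_const))
  contMDiff_proj := E.frameAtlas.contMDiff_proj
  free z g h := DVAut.eq_of_smul_eq fun v => by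
    rw [one_smul]
    exact z.2.bijOn.injOn trivial trivial (congrArg (fun w : E.FrameTotal => w.1.2 v) h)
  proj_eq_iff z w := by
    constructor
    · intro h
      have h' : z.1.1 = w.1.1 := h
      let t := E.trivAt z.1.1
      have hz : z.1.1 ∈ t.base := E.mem_trivAt_base _
      -- Two frames over one point differ by the quotient of their coordinates.
      refine ⟨(t.frameCoord z)⁻¹ * t.frameCoord w, FrameTotal.ext h'.symm fun v => ?_⟩
      change w.1.2 v = z.1.2 _
      rw [← t.point_frameCoord_smul hz, ← t.point_frameCoord_smul (z := w) (h' ▸ hz),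
        smul_smul, mul_inv_cancel_left, h']
    · rintro ⟨g, rfl⟩
      rfl
  surjective_proj x := ⟨E.framePoint x x 1, framePoint_fst x x 1⟩
  locallyTrivial x := by
    let t := E.frameAtlas.triv x
    refine ⟨t.base, t.isOpen_base, E.mem_trivAt_base x, t.φ, t.source_eq, t.target_eq,
      t.contMDiffOn_φ, t.contMDiffOn_symm, fun z hz => ⟨t.fst_φ z hz, fun g => ?_⟩⟩
    have hz' : z.1.1 ∈ (E.trivAt x).base := hz
    refine Prod.ext rfl (DVAut.eq_of_smul_eq fun v => ?_)
    rw [mul_smul]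
    exact ((E.trivAt x).frameCoord_smul (z := E.frameAct z g) hz' v).trans
      ((E.trivAt x).frameCoord_smul hz' (g • v)).symm

/-- The value of a frame on a vector. -/
def frameApply (z : E.frame.Total) (v : DVS d d' d₀) : E.Total := z.1.2 v

theorem isFrame_frameApply (z : E.frame.Total) : IsFrame E (E.frame.proj z) (E.frameApply z) := z.2

theorem contMDiff_frameApply :
    ContMDiff (((𝓡 n).prod (DVAutI d d' d₀)).prod 𝓘(ℝ, DVS d d' d₀))
      ((𝓡 n).prod 𝓘(ℝ, DVS d d' d₀)) ∞
      (fun z : E.frame.Total × DVS d d' d₀ => E.frameApply z.1 z.2) :=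
  E.contMDiff_frame_apply

theorem isFrameBundle : IsFrameBundle E E.frame E.frameApply where
  isFrame := E.isFrame_frameApply
  existsUnique x ψ h := by
    refine ⟨(⟨(x, ψ), h⟩ : E.FrameTotal), ⟨rfl, rfl⟩, ?_⟩
    rintro z ⟨rfl, rfl⟩
    rfl
  act _ _ _ := rfl
  contMDiff := E.contMDiff_frameApply

variable {E} in
/-- The map of frame bundles `ψ ↦ f ∘ ψ`. -/
def frameHom {F : DoubleVectorBundle n M d d' d₀} (f : E ≅ F) : E.frame ⟶ F.frame where
  toFun z := (⟨(z.1.1, fun v => f.hom.toFun (z.1.2 v)), z.2.comp_iso f⟩ : F.FrameTotal)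
  contMDiff := contMDiff_frame_of_apply fun _ =>
    f.hom.contMDiff.comp (E.contMDiff_frame_apply.comp (contMDiff_id.prodMk contMDiff_const))
  proj_comp _ := rfl
  equivariant _ _ := rfl

variable (n M d d' d₀) in
/-- The frame bundle functor. -/
def frameFunctor : Core (DoubleVectorBundle n M d d' d₀) ⥤ DVPrincipal n M d d' d₀ where
  obj E := E.of.frame
  map f := frameHom f.iso
  map_id _ := rfl
  map_comp _ _ := rfl

/-! ### The natural isomorphisms -/

/-- The map `[ψ, v] ↦ ψ v`. -/
def counitHom : E.frame.assoc ⟶ E where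
  toFun := PrincipalBundle.assocLift E.frameApply fun _ _ _ => rfl
  contMDiff := E.frame.contMDiff_of_comp_assocQ E.contMDiff_frameApply
  proj_comp e := by
    obtain ⟨z, v, rfl⟩ := PrincipalBundle.exists_assocMk_eq e
    exact (E.isFrame_frameApply z).proj_eq v
  map_h₁ c e := by
    obtain ⟨z, v, rfl⟩ := PrincipalBundle.exists_assocMk_eq e
    exact (E.isFrame_frameApply z).map_h₁ c v
  map_h₂ c e := by
    obtain ⟨z, v, rfl⟩ := PrincipalBundle.exists_assocMk_eq e
    exact (E.isFrame_frameApply z).map_h₂ c v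

/-- Frames over one point differ by a group element, which reduces injectivity to that of a single
frame; surjectivity holds because a frame fills its fibre. -/
theorem counitHom_bijective : Function.Bijective E.counitHom.toFun := by
  constructor
  · intro a b h
    obtain ⟨z, v, rfl⟩ := PrincipalBundle.exists_assocMk_eq a
    obtain ⟨w, v', rfl⟩ := PrincipalBundle.exists_assocMk_eq b
    have h' : E.frameApply z v = E.frameApply w v' := h
    obtain ⟨g, rfl⟩ := (E.frame.proj_eq_iff z w).1 (by
      rw [← (E.isFrame_frameApply z).proj_eq v, h', (E.isFrame_frameApply w).proj_eq])
    have hv : v = g • v' := (E.isFrame_frameApply z).bijOn.injOn trivial trivial h'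
    rw [PrincipalBundle.assocMk_act, hv]
  · intro e
    obtain ⟨z, hz⟩ := E.frame.surjective_proj (E.proj e)
    obtain ⟨v, -, hv⟩ := (E.isFrame_frameApply z).bijOn.surjOn (show e ∈ _ from hz.symm)
    exact ⟨E.frame.assocQ (z, v), hv⟩

/-- The inverse of `[ψ, v] ↦ ψ v`. -/
def counitInv : E ⟶ E.frame.assoc := by
  let k := Equiv.ofBijective _ E.counitHom_bijective
  have hk (e) : E.counitHom.toFun (k.symm e) = e := k.apply_symm_apply e
  refine ⟨k.symm, fun e₀ => ?_, fun e => ?_, fun c e => E.counitHom_bijective.1 ?_,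
    fun c e => E.counitHom_bijective.1 ?_⟩
  · let i := E.proj e₀
    let t := E.trivAt i
    have ht : E.proj e₀ ∈ t.base := E.mem_trivAt_base _
    have hp : ContMDiffAt ((𝓡 n).prod 𝓘(ℝ, DVS d d' d₀)) (𝓡 n) ∞ E.proj e₀ :=
      E.contMDiff_proj e₀
    -- The local frame with coordinate `1` is smooth, and near `e₀` the inverse sends `e` to the
    -- class of this frame paired with the fibre coordinate of `e`.
    have h1 : ContMDiffAt ((𝓡 n).prod 𝓘(ℝ, DVS d d' d₀)) ((𝓡 n).prod (DVAutI d d' d₀)) ∞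
        (fun e => (E.frameAtlas.triv i).point (E.proj e) 1) e₀ :=
      SmoothTriv.contMDiffAt_point_comp (a := E.proj) ht hp contMDiffAt_const
    have h2 := SmoothTriv.contMDiffAt_coord (t := t.toSmoothTriv) ht
    have h3 := (E.frame.contMDiff_assocQ _).comp e₀ (h1.prodMk h2)
    refine h3.congr_of_eventuallyEq ?_
    filter_upwards [hp.continuousAt.preimage_mem_nhds (t.isOpen_base.mem_nhds ht)] with e he
    refine E.counitHom_bijective.1 ((hk e).trans ?_)
    refine ((framePoint_apply he 1 _).trans ?_).symm
    rw [one_smul]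
    exact SmoothTriv.point_coord he
  · rw [← E.counitHom.proj_comp, hk]
  · rw [hk, E.counitHom.map_h₁, hk]
  · rw [hk, E.counitHom.map_h₂, hk]

/-- The isomorphism `[ψ, v] ↦ ψ v`. -/
def counitIso : E.frame.assoc ≅ E where
  hom := E.counitHom
  inv := E.counitInv
  hom_inv_id := DoubleVectorBundle.Hom.ext
    (funext fun e => (Equiv.ofBijective _ E.counitHom_bijective).symm_apply_apply e)
  inv_hom_id := DoubleVectorBundle.Hom.ext
    (funext fun e => (Equiv.ofBijective _ E.counitHom_bijective).apply_symm_apply e)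

end DoubleVectorBundle

namespace PrincipalBundle

variable (P : DVPrincipal n M d d' d₀) [IsManifold (𝓡 n) ∞ M] [T2Space M]
  [SecondCountableTopology M]

/-- Freeness of the action gives injectivity, and transitivity on the fibres of `P` gives
surjectivity onto the fibre. -/
theorem isFrame_assocQ (p : P.Total) :
    IsFrame P.assoc (P.proj p) (fun v => P.assocQ (p, v)) where
  contMDiff := P.contMDiff_assocQ.comp (contMDiff_const.prodMk contMDiff_id)
  bijOn := by
    refine ⟨fun v _ => rfl, fun v _ w _ h => ?_, fun e he => ?_⟩
    · obtain ⟨g, h1, h2⟩ := assocMk_eq_iff.1 h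
      rw [P.free _ _ h1.symm] at h2
      simpa using h2.symm
    · obtain ⟨q, v, rfl⟩ := exists_assocMk_eq e
      obtain ⟨g, rfl⟩ := (P.proj_eq_iff p q).1 (Eq.symm he)
      exact ⟨g • v, trivial, (assocMk_act p g v).symm⟩
  map_h₁ _ _ := rfl
  map_h₂ _ _ := rfl

/-- The map `p ↦ (v ↦ [p, v])`. -/
def unitHom : P ⟶ P.assoc.frame where
  toFun p := (⟨(P.proj p, fun v => P.assocQ (p, v)), P.isFrame_assocQ p⟩ : P.assoc.FrameTotal)
  contMDiff := DoubleVectorBundle.contMDiff_frame_of_apply fun _ =>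
    P.contMDiff_assocQ.comp (contMDiff_id.prodMk contMDiff_const)
  proj_comp _ := rfl
  equivariant p g := DoubleVectorBundle.FrameTotal.ext (P.proj_act p g) fun v => assocMk_act p g v

variable (n M d d' d₀) in
/-- The associated bundle and the frame bundle are mutually inverse equivalences. -/
def equivalence : DVPrincipal n M d d' d₀ ≌ Core (DoubleVectorBundle n M d d' d₀) where
  functor := assocCore n M d d' d₀
  inverse := DoubleVectorBundle.frameFunctor n M d d' d₀
  unitIso := NatIso.ofComponents (fun P => Hom.toIso P.unitHom) fun {P Q} f =>
    PrincipalBundle.Hom.ext <| funext fun p =>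
      DoubleVectorBundle.FrameTotal.ext (f.proj_comp p) fun _ => rfl
  counitIso := NatIso.ofComponents (fun E => Core.isoMk E.of.counitIso) fun {E F} f =>
    Core.hom_ext <| DoubleVectorBundle.Hom.ext <| funext fun e => by
      obtain ⟨z, v, rfl⟩ := exists_assocMk_eq e
      rfl
  functor_unitIso_comp P := Core.hom_ext <| DoubleVectorBundle.Hom.ext <| funext fun e => by
    obtain ⟨p, v, rfl⟩ := exists_assocMk_eq e
    rfl

end PrincipalBundle

end

/-! ### The main theorem -/

theorem mainTheorem3 (d d' d₀ n : ℕ) (M : Type u) [TopologicalSpace M]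
    [ChartedSpace (EuclideanSpace ℝ (Fin n)) M] [IsManifold (𝓡 n) ∞ M] [T2Space M]
    [SecondCountableTopology M] :
    -- `DVAut` is the group of diffeomorphisms preserving the double vector space structure
    (∀ f : DVS d d' d₀ → DVS d d' d₀,
      (∃ φ : Diffeomorph 𝓘(ℝ, DVS d d' d₀) 𝓘(ℝ, DVS d d' d₀) (DVS d d' d₀) (DVS d d' d₀) ∞,
        ⇑φ = f ∧ ∀ t v, f (DVS.h₁ t v) = DVS.h₁ t (f v) ∧ f (DVS.h₂ t v) = DVS.h₂ t (f v)) ↔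
      ∃! g : DVAut d d' d₀, ∀ v, f v = g • v) ∧
    -- it is a double principal group
    IsDoublePrincipalGroup (DVAutI d d' d₀) (DVAut d d' d₀)
      (DVAut.fixFst d d' d₀) (DVAut.fixSnd d d' d₀) ∧
    -- the associated bundle functor and the frame bundle functor are mutually inverse equivalences
    ∃ (e : DVPrincipal n M d d' d₀ ≌ Core (DoubleVectorBundle n M d d' d₀))
      (q : ∀ P : DVPrincipal n M d d' d₀, P.Total × DVS d d' d₀ → (e.functor.obj P).of.Total)
      (ε : ∀ E : Core (DoubleVectorBundle n M d d' d₀),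
        (e.inverse.obj E).Total → DVS d d' d₀ → E.of.Total),
      -- on objects and morphisms, `e.functor` is the associated bundle construction
      (∀ P, IsAssociatedBundle P (e.functor.obj P).of (q P)) ∧
      (∀ (P Q : DVPrincipal n M d d' d₀) (f : P ⟶ Q) (p : P.Total) (v : DVS d d' d₀),
        (e.functor.map f).iso.hom.toFun (q P (p, v)) = q Q (f.toFun p, v)) ∧
      -- on objects and morphisms, `e.inverse` is the frame bundle construction
      (∀ E, IsFrameBundle E.of (e.inverse.obj E) (ε E)) ∧
      (∀ (E F : Core (DoubleVectorBundle n M d d' d₀)) (f : E ⟶ F) (p : (e.inverse.obj E).Total)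
        (v : DVS d d' d₀), ε F ((e.inverse.map f).toFun p) v = f.iso.hom.toFun (ε E p v)) ∧
      -- the natural isomorphisms are `p ↦ (v ↦ [p, v])` and `[ψ, v] ↦ ψ v`
      (∀ (P : DVPrincipal n M d d' d₀) (p : P.Total) (v : DVS d d' d₀),
        ε (e.functor.obj P) ((e.unit.app P).toFun p) v = q P (p, v)) ∧
      (∀ (E : Core (DoubleVectorBundle n M d d' d₀)) (p : (e.inverse.obj E).Total)
        (v : DVS d d' d₀),
        (e.counit.app E).iso.hom.toFun (q (e.inverse.obj E) (p, v)) = ε E p v) := by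
  refine ⟨DVAut.exists_diffeomorph_iff, DVAut.isDoublePrincipalGroup,
    PrincipalBundle.equivalence n M d d' d₀, PrincipalBundle.assocQ,
    fun E => E.of.frameApply, fun P => P.isAssociatedBundle, fun _ _ _ _ _ => rfl,
    fun E => E.of.isFrameBundle, fun _ _ _ _ _ => rfl, fun _ _ _ => rfl, fun _ _ _ => rfl⟩
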